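/- Notation. $\mathbb D$ is the open unit disc and $\mathbb T$ the unit circle of $\mathbb C$. For a bounded domain $\Omega\subset\mathbb C^d$, let $A(\Omega)$ be the algebra of continuous functions on $\overline\Omega$ that are holomorphic in $\Omega$; the distinguished boundary $b\Omega$ is the smallest closed subset of $\overline\Omega$ on which every function in $A(\Omega)$ attains its maximum modulus over $\overline\Omega$. A rational $\Omega$-inner function is a $d$-tuple $x=(x_1,\dots,x_d)$ of rational functions with poles outside $\overline{\mathbb D}$ such that $x(\lambda)\in\overline\Omega$ for $\lambda\in\mathbb D$ and $x(\lambda)\in b\Omega$ for $\lambda\in\mathbb T$. With $\|\cdot\|$ the Euclidean operator norm on complex $2\times 2$ matrices, let $\mathbb G=\{(\operatorname{tr}A,\det A):\|A\|<1\}\subset\mathbb C^2$, with closure $\Gamma$, and let the pentablock be $\mathcal P=\{(a_{21},\operatorname{tr}A,\det A):A=[a_{ij}],\ \|A\|<1\}\subset\mathbb C^3$; rational $\mathbb G$-inner functions are called rational $\Gamma$-inner, and rational $\mathcal P$-inner functions rational pentablock-inner. The degree of a rational function $f/g$ in lowest terms is $\max(\deg f,\deg g)$. For a polynomial $f$ of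 degree at most $n$, $f^{\sim n}$ is the polynomial with $f^{\sim n}(\lambda)=\lambda^n\overline{f(1/\overline\lambda)}$. A finite Blaschke product is a function $B(z)=e^{i\theta}\prod_{j=1}^m\frac{z-a_j}{1-\overline{a_j}z}$ with $\theta\in\mathbb R$, $m\ge 0$ and $a_1,\dots,a_m\in\mathbb D$. Theorem. Let $n\ge 0$ be an integer. (A) Let $x=(x_1,x_2,x_3)$ be a rational pentablock-inner function such that $x_3$ has degree $n$. Then there exist polynomials $N_1,N_2,D$ and a finite Blaschke product $B$ such that 1. $D$ has degree at most $n$ and no zero in $\overline{\mathbb D}$, and $(x_2,x_3)=\left(\frac{N_2}{D},\frac{D^{\sim n}}{D}\right)$ is a rational $\Gamma$-inner function; 2. $x_1=B\,\frac{N_1}{D}$ on $\overline{\mathbb D}$; 3. $|N_1(\lambda)|^2=|D(\lambda)|^2-\frac14|N_2(\lambda)|^2$ for all $\lambda\in\mathbb T$; 4. $\deg N_1\le n$. (B) Conversely, let $N_1,N_2,D$ be polynomials such that $D$ has degree at most $n$ and no zero in $\overline{\mathbb D}$, $\left(\frac{N_2}{D},\frac{D^{\sim n}}{D}\right)$ is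 a rational $\Gamma$-inner function, and condition 3 holds. Then $\left(\frac{N_1}{D},\frac{N_2}{D},\frac{D^{\sim n}}{D}\right)$ is a rational pentablock-inner function, and $\frac{D^{\sim n}}{D}$ has degree equal to $n$. (C) Furthermore, let $x$ be as in (A), and let $N_1,N_2,D$ and $B$ satisfy conditions 1–4. Then polynomials $N_1',N_2',D'$ satisfy conditions 1–4 with the same $x$, $n$ and $B$ if and only if there is a nonzero real number $t$ such that $N_1=tN_1'$, $N_2=tN_2'$ and $D=tD'$. -/

import Mathlib

open Polynomial

noncomputable section

namespace PentaInner

/-- `C` is a boundary for `Ω`: a subset of the closure of `Ω` on which every function in `A(Ω)`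
(continuous on the closure of `Ω` and holomorphic in `Ω`) attains its maximum modulus. -/
def IsBoundary {d : ℕ} (Ω C : Set (Fin d → ℂ)) : Prop :=
  C ⊆ closure Ω ∧
    ∀ f : (Fin d → ℂ) → ℂ, DiffContOnCl ℂ f Ω → ∃ c ∈ C, ∀ w ∈ closure Ω, ‖f w‖ ≤ ‖f c‖

/-- The distinguished boundary `bΩ`: the smallest closed boundary for `Ω`, i.e. the intersection
of all closed boundaries (for bounded `Ω` this is the Shilov boundary of `A(Ω)`). -/
def distinguishedBoundary {d : ℕ} (Ω : Set (Fin d → ℂ)) : Set (Fin d → ℂ) :=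
  ⋂₀ {C | IsClosed C ∧ IsBoundary Ω C}

/-- The open unit ball of the complex `2 × 2` matrices for the operator norm on `ℂ²` with the
Euclidean norm. -/
def matrixBall : Set (Matrix (Fin 2) (Fin 2) ℂ) :=
  {A | ‖Matrix.toEuclideanCLM (𝕜 := ℂ) A‖ < 1}

/-- The symmetrized bidisc `𝔾`; its closure is `Γ`. -/
def symmetrizedBidisc : Set (Fin 2 → ℂ) :=
  {w | ∃ A ∈ matrixBall, w = ![A.trace, A.det]}

/-- The pentablock `𝒫`. -/
def pentablock : Set (Fin 3 → ℂ) :=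
  {w | ∃ A ∈ matrixBall, w = ![A 1 0, A.trace, A.det]}

/-- The value of a rational function at `z`. -/
def ratEval (r : RatFunc ℂ) (z : ℂ) : ℂ := r.eval (RingHom.id ℂ) z

/-- The degree of a rational function: the maximum of the degrees of the numerator and the
denominator in lowest terms. -/
def ratDegree (r : RatFunc ℂ) : ℕ := max r.num.natDegree r.denom.natDegree

/-- The rational function `p / q` given by two polynomials. -/
def ratQuot (p q : ℂ[X]) : RatFunc ℂ :=
  algebraMap ℂ[X] (RatFunc ℂ) p / algebraMap ℂ[X] (RatFunc ℂ) q

/-- Rational `Ω`-inner functions: tuples of rational functions with poles outside the closed unit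
disc that map the open disc to the closure of `Ω` and the unit circle to `bΩ`. -/
structure IsRationalInner {d : ℕ} (Ω : Set (Fin d → ℂ)) (x : Fin d → RatFunc ℂ) : Prop where
  poles : ∀ i, ∀ z ∈ Metric.closedBall (0 : ℂ) 1, (x i).denom.eval z ≠ 0
  mapsDisc : ∀ z ∈ Metric.ball (0 : ℂ) 1, (fun i => ratEval (x i) z) ∈ closure Ω
  mapsCircle : ∀ z ∈ Metric.sphere (0 : ℂ) 1,
    (fun i => ratEval (x i) z) ∈ distinguishedBoundary Ω

/-- `B` is a finite Blaschke product `e^{iθ} ∏ (z - a_j) / (1 - conj a_j z)` with all `a_j` in the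
open unit disc; the empty product (a unimodular constant) is allowed. -/
def IsFiniteBlaschke (B : ℂ → ℂ) : Prop :=
  ∃ (θ : ℝ) (m : ℕ) (a : Fin m → ℂ), (∀ j, ‖a j‖ < 1) ∧
    ∀ z, B z = Complex.exp (θ * Complex.I) *
      ∏ j, (z - a j) / (1 - (starRingEnd ℂ) (a j) * z)

/-- The polynomial `f^{∼n}`, obtained by conjugating the coefficients `a_k` of `f` and putting
`conj a_k` in degree `n - k`; only used for `deg f ≤ n`. -/
def conjReverse (n : ℕ) (f : ℂ[X]) : ℂ[X] := (f.map (starRingEnd ℂ)).reflect n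

/-- The formula `f^{∼n}(z) = zⁿ * conj (f (1 / conj z))` for `deg f ≤ n` and `z ≠ 0`. -/
theorem conjReverse_eval (n : ℕ) (f : ℂ[X]) (hf : f.natDegree ≤ n) (z : ℂ) (hz : z ≠ 0) :
    (conjReverse n f).eval z
      = z ^ n * (starRingEnd ℂ) (f.eval (1 / (starRingEnd ℂ) z)) := by
  have hinv : z⁻¹ ≠ 0 := inv_ne_zero hz
  let _ : Invertible z⁻¹ := invertibleOfNonzero hinv
  have h := Polynomial.eval₂_reflect_mul_pow (RingHom.id ℂ) z⁻¹ n (f.map (starRingEnd ℂ))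
    (Polynomial.natDegree_map_le.trans hf)
  have hz' : (⅟(z⁻¹) : ℂ) = z := by simp
  have hc : (starRingEnd ℂ) (f.eval (1 / (starRingEnd ℂ) z))
      = (f.map (starRingEnd ℂ)).eval z⁻¹ := by
    have hw : z⁻¹ = (starRingEnd ℂ) (1 / (starRingEnd ℂ) z) := by simp
    rw [hw, Polynomial.eval_map, Polynomial.eval₂_at_apply]
  rw [hz'] at h
  rw [hc, conjReverse]
  simp only [Polynomial.eval₂_id] at h
  rw [← h, mul_left_comm, ← mul_pow, mul_inv_cancel₀ hz, one_pow, mul_one]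

/-- `(N₂/D, D^{∼n}/D)` is a rational `Γ`-inner function, where `D` has degree at most `n` (so that
`D^{∼n}` makes sense) and no zero in the closed disc (so that the quotients make sense there). -/
structure IsGammaPair (n : ℕ) (N₂ D : ℂ[X]) : Prop where
  degree_le : D.natDegree ≤ n
  no_zero : ∀ z ∈ Metric.closedBall (0 : ℂ) 1, D.eval z ≠ 0
  inner : IsRationalInner symmetrizedBidisc ![ratQuot N₂ D, ratQuot (conjReverse n D) D]

/-- `|N₁|² = |D|² - |N₂|²/4` on the unit circle. -/
def CircleIdentity (N₁ N₂ D : ℂ[X]) : Prop :=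
  ∀ z ∈ Metric.sphere (0 : ℂ) 1,
    ‖N₁.eval z‖ ^ 2 = ‖D.eval z‖ ^ 2 - ‖N₂.eval z‖ ^ 2 / 4

/-- The triple `(N₁, N₂, D)` represents `x = (x₁, x₂, x₃)` with Blaschke factor `B`. The
coordinates `x₁, x₂, x₃` are `x 0, x 1, x 2`. -/
structure Represents (n : ℕ) (x : Fin 3 → RatFunc ℂ) (B : ℂ → ℂ) (N₁ N₂ D : ℂ[X]) : Prop where
  gamma : IsGammaPair n N₂ D
  second : x 1 = ratQuot N₂ D
  third : x 2 = ratQuot (conjReverse n D) D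
  first : ∀ z ∈ Metric.closedBall (0 : ℂ) 1,
    ratEval (x 0) z = B z * (N₁.eval z / D.eval z)
  circle : CircleIdentity N₁ N₂ D
  degree_le : N₁.natDegree ≤ n

end PentaInner

end

/-!
The Möbius maps `A ↦ (A - α) (1 - ᾱ A)⁻¹` of the matrix ball induce rational automorphisms
`pentaMobius α` of the pentablock. Every point of the pentablock is moved by one of them to the slice
`s = 0` (`exists_trace_pentaMobius_eq_zero`; `α` is a hyperbolic midpoint of the eigenvalues), and
this slice is the bidisc `{(a, 0, p) : |a|, |p| < 1}` (`mem_pentablock_of_trace_zero`). This reduces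
most questions about the pentablock to the bidisc.

In particular it gives the distinguished boundary
`b𝒫 = {|p| = 1, s = s̄ p, |a|² = 1 - |s|² / 4}` (`distinguishedBoundary_pentablock`). This set is a
boundary because analytic discs in the bidisc with boundary in the torus pass through every point of
the slice, and it is the smallest one because each of its points is a peak point. The distinguished
boundary of `𝔾` is handled in the same way, through the map `(a, s, p) ↦ (s, p)` and its section
`(s, p) ↦ (0, s, p)`.

For a rational pentablock-inner function, the values on the circle are now described by three
identities. Since `x₃` is unimodular there, it equals `D^{∼n} / D`
(`exists_conjReverse_quotient`). From `x₂ = x̄₂ x₃` one gets that `D` is a denominator of `x₂`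
(`dvd_mul_of_symmetry`). After the zeros of `x₁` in the disc are split off as a Blaschke product
(`exists_blaschke_factorization`), the identity `|x₁|² = 1 - |x₂|² / 4` shows that `D` is also a
denominator of the remaining factor (`dvd_mul_of_circle`). Each divisibility is obtained by turning
the identity on the circle into one between polynomials and observing that the reversed polynomials
have their zeros in the closed disc, away from the poles.

Conversely, given `N₁, N₂, D`, the values on the circle lie in `b𝒫` by the description above. At a
point of the disc, a Möbius map takes the last two coordinates to trace zero; by the maximum
principle the first coordinate of the image has modulus at most one, so the image lies in the closed
bidisc, and mapping back gives a point of the closed pentablock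
(`smul_mem_closure_of_circleIdentity`). Uniqueness holds because `D^{∼n} / D` is in lowest terms.
-/

noncomputable section

namespace PentaInner

open ComplexConjugate Topology

/-! ### Contractive `2 × 2` matrices -/

/-- Membership in the open matrix ball in coordinates; `r` bounds the *square* of the norm. -/
theorem mem_matrixBall_iff (A : Matrix (Fin 2) (Fin 2) ℂ) :
    A ∈ matrixBall ↔ ∃ r : ℝ, r < 1 ∧ ∀ u v : ℂ,
      ‖A 0 0 * u + A 0 1 * v‖ ^ 2 + ‖A 1 0 * u + A 1 1 * v‖ ^ 2 ≤ r * (‖u‖ ^ 2 + ‖v‖ ^ 2) := by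
  have key : ∀ u v : ℂ, ‖Matrix.toEuclideanCLM (𝕜 := ℂ) A (WithLp.toLp 2 ![u, v])‖ ^ 2
      = ‖A 0 0 * u + A 0 1 * v‖ ^ 2 + ‖A 1 0 * u + A 1 1 * v‖ ^ 2 := by
    intro u v
    rw [Matrix.toEuclideanCLM_toLp, EuclideanSpace.norm_sq_eq]
    simp [Fin.sum_univ_two, Matrix.mulVec, dotProduct]
  have key2 : ∀ u v : ℂ, ‖(WithLp.toLp 2 ![u, v] : EuclideanSpace ℂ (Fin 2))‖ ^ 2
      = ‖u‖ ^ 2 + ‖v‖ ^ 2 := by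
    intro u v
    rw [EuclideanSpace.norm_sq_eq]
    simp [Fin.sum_univ_two]
  constructor
  · intro h
    have h : ‖Matrix.toEuclideanCLM (𝕜 := ℂ) A‖ < 1 := h
    refine ⟨‖Matrix.toEuclideanCLM (𝕜 := ℂ) A‖ ^ 2, by
      nlinarith [norm_nonneg (Matrix.toEuclideanCLM (𝕜 := ℂ) A)], fun u v => ?_⟩
    rw [← key, ← key2, ← mul_pow]
    exact pow_le_pow_left₀ (norm_nonneg _) (ContinuousLinearMap.le_opNorm _ _) 2
  · rintro ⟨r, hr, h⟩
    have hr0 : 0 ≤ r := by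
      have := h 1 0
      simp only [norm_one, norm_zero] at this
      nlinarith [sq_nonneg ‖A 0 0 * 1 + A 0 1 * 0‖, sq_nonneg ‖A 1 0 * 1 + A 1 1 * 0‖]
    have : ‖Matrix.toEuclideanCLM (𝕜 := ℂ) A‖ ≤ √r := by
      refine ContinuousLinearMap.opNorm_le_bound _ (Real.sqrt_nonneg _) fun x => ?_
      have hx : x = WithLp.toLp 2 ![x 0, x 1] := by
        ext i; fin_cases i <;> simp
      refine (sq_le_sq₀ (norm_nonneg _) (by positivity)).1 ?_
      rw [hx, key, mul_pow, key2, Real.sq_sqrt hr0]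
      exact h _ _
    exact this.trans_lt (by rw [Real.sqrt_lt' one_pos]; simpa using hr)

theorem matrixBall_diag {l m : ℂ} (hl : ‖l‖ < 1) (hm : ‖m‖ < 1) :
    (!![l, 0; 0, m] : Matrix (Fin 2) (Fin 2) ℂ) ∈ matrixBall := by
  rw [mem_matrixBall_iff]
  have hl2 : ‖l‖ ^ 2 < 1 := by nlinarith [norm_nonneg l]
  have hm2 : ‖m‖ ^ 2 < 1 := by nlinarith [norm_nonneg m]
  refine ⟨max (‖l‖ ^ 2) (‖m‖ ^ 2), max_lt hl2 hm2, fun u v => ?_⟩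
  simp only [Matrix.of_apply, Matrix.cons_val', Matrix.cons_val_zero, Matrix.cons_val_one,
    Matrix.cons_val_fin_one, zero_mul, add_zero, zero_add, norm_mul, mul_pow]
  rw [mul_add]
  gcongr
  · exact le_max_left _ _
  · exact le_max_right _ _

theorem det_one_sub_ne_zero {A : Matrix (Fin 2) (Fin 2) ℂ} (hA : A ∈ matrixBall) {c : ℂ}
    (hc : ‖c‖ ≤ 1) : 1 - c * A.trace + c ^ 2 * A.det ≠ 0 := by
  intro h0
  have hdet : (1 - c • A).det = 0 := by
    rw [← h0, Matrix.det_fin_two, Matrix.trace_fin_two, Matrix.det_fin_two]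
    simp
    ring
  obtain ⟨v, hv, hv0⟩ := Matrix.exists_mulVec_eq_zero_iff.2 hdet
  obtain ⟨r, hr, h⟩ := (mem_matrixBall_iff A).1 hA
  have h1 := h (v 0) (v 1)
  have e0 : v 0 = c * (A 0 0 * v 0 + A 0 1 * v 1) := by
    have := congrFun hv0 0
    simp [Matrix.mulVec, dotProduct, Fin.sum_univ_two] at this
    linear_combination this
  have e1 : v 1 = c * (A 1 0 * v 0 + A 1 1 * v 1) := by
    have := congrFun hv0 1
    simp [Matrix.mulVec, dotProduct, Fin.sum_univ_two] at this
    linear_combination this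
  have n0 : ‖v 0‖ ^ 2 ≤ ‖A 0 0 * v 0 + A 0 1 * v 1‖ ^ 2 := by
    gcongr
    conv_lhs => rw [e0, norm_mul]
    exact mul_le_of_le_one_left (norm_nonneg _) hc
  have n1 : ‖v 1‖ ^ 2 ≤ ‖A 1 0 * v 0 + A 1 1 * v 1‖ ^ 2 := by
    gcongr
    conv_lhs => rw [e1, norm_mul]
    exact mul_le_of_le_one_left (norm_nonneg _) hc
  have hz : ‖v 0‖ ^ 2 + ‖v 1‖ ^ 2 = 0 := by
    nlinarith [sq_nonneg ‖v 0‖, sq_nonneg ‖v 1‖]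
  have z0 : v 0 = 0 := by
    have : ‖v 0‖ ^ 2 = 0 := by nlinarith [sq_nonneg ‖v 0‖, sq_nonneg ‖v 1‖]
    simpa using this
  have z1 : v 1 = 0 := by
    have : ‖v 1‖ ^ 2 = 0 := by nlinarith [sq_nonneg ‖v 0‖, sq_nonneg ‖v 1‖]
    simpa using this
  exact hv (by ext i; fin_cases i <;> simp [z0, z1])

theorem exists_sum_prod (s p : ℂ) : ∃ l m : ℂ, s = l + m ∧ p = l * m := by
  obtain ⟨d, hd⟩ := IsAlgClosed.exists_pow_nat_eq (s ^ 2 - 4 * p) (n := 2) two_pos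
  exact ⟨(s + d) / 2, (s - d) / 2, by ring, by linear_combination (1 / 4 : ℂ) * hd⟩

theorem exists_eigenvalues {A : Matrix (Fin 2) (Fin 2) ℂ} (hA : A ∈ matrixBall) :
    ∃ l m : ℂ, ‖l‖ < 1 ∧ ‖m‖ < 1 ∧ A.trace = l + m ∧ A.det = l * m := by
  obtain ⟨l, m, hs, hp⟩ := exists_sum_prod A.trace A.det
  have main : ∀ l m : ℂ, A.trace = l + m → A.det = l * m → ‖l‖ < 1 := by
    intro l m hs hp
    by_contra! hl
    have hl0 : l ≠ 0 := by rintro rfl; simp at hl; linarith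
    refine det_one_sub_ne_zero hA (c := l⁻¹) (by rw [norm_inv]; exact inv_le_one_of_one_le₀ hl) ?_
    rw [hs, hp]
    field_simp
    ring
  exact ⟨l, m, main l m hs hp, main m l (by rw [hs, add_comm]) (by rw [hp, mul_comm]), hs, hp⟩

theorem norm_sq_mobius (a x y : ℂ) :
    ‖x - conj a * y‖ ^ 2 - ‖y - a * x‖ ^ 2 = (1 - ‖a‖ ^ 2) * (‖x‖ ^ 2 - ‖y‖ ^ 2) := by
  simp only [Complex.sq_norm, Complex.normSq_apply, Complex.sub_re, Complex.sub_im, Complex.mul_re,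
    Complex.mul_im, Complex.conj_re, Complex.conj_im]
  ring

theorem mul_conj_norm (a : ℂ) : a * conj a = ((‖a‖ ^ 2 : ℝ) : ℂ) := by
  rw [Complex.mul_conj, Complex.normSq_eq_norm_sq]

theorem norm_sq_sub_le (a x y : ℂ) (ha : ‖a‖ ≤ 1) :
    ‖x - conj a * y‖ ^ 2 ≤ 2 * (‖x‖ ^ 2 + ‖y‖ ^ 2) := by
  have h1 : ‖x - conj a * y‖ ≤ ‖x‖ + ‖y‖ := by
    refine (norm_sub_le _ _).trans ?_
    rw [norm_mul, Complex.norm_conj]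
    nlinarith [norm_nonneg y]
  nlinarith [norm_nonneg (x - conj a * y), sq_nonneg (‖x‖ - ‖y‖)]

/-! ### Möbius maps of the pentablock -/

/-- The denominator `1 - ᾱ s + ᾱ² p` at `w = (a, s, p)`; it equals `det (1 - ᾱ A)` if
`s = tr A` and `p = det A`. -/
def mobiusDenom (α : ℂ) (w : Fin 3 → ℂ) : ℂ := 1 - conj α * w 1 + conj α ^ 2 * w 2

/-- The map induced on `(a₂₁, tr A, det A)` by `A ↦ (A - α) (1 - ᾱ A)⁻¹`. -/
def pentaMobius (α : ℂ) (w : Fin 3 → ℂ) : Fin 3 → ℂ :=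
  ![(1 - α * conj α) * w 0 / mobiusDenom α w,
    ((1 + α * conj α) * w 1 - 2 * conj α * w 2 - 2 * α) / mobiusDenom α w,
    (w 2 - α * w 1 + α ^ 2) / mobiusDenom α w]

theorem pentaMobius_mem {α : ℂ} (hα : ‖α‖ < 1) {w : Fin 3 → ℂ} (hw : w ∈ pentablock) :
    pentaMobius α w ∈ pentablock := by
  obtain ⟨A, hA, rfl⟩ := hw
  have hQ : 1 - conj α * A.trace + conj α ^ 2 * A.det ≠ 0 :=
    det_one_sub_ne_zero hA (by simpa using hα.le)
  set Q := 1 - conj α * A.trace + conj α ^ 2 * A.det with hQdef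
  set κ := α + conj α * A.det - α * conj α * A.trace with hκ
  -- By Cayley–Hamilton, `(A - α) (1 - ᾱ A)⁻¹` is this linear combination of `A` and `1`.
  let M : Matrix (Fin 2) (Fin 2) ℂ :=
    !![((1 - α * conj α) * A 0 0 - κ) / Q, (1 - α * conj α) * A 0 1 / Q;
       (1 - α * conj α) * A 1 0 / Q, ((1 - α * conj α) * A 1 1 - κ) / Q]
  refine ⟨M, ?_, ?_⟩
  · obtain ⟨r, hr, h⟩ := (mem_matrixBall_iff A).1 hA
    rw [mem_matrixBall_iff]
    have hα2 : 0 < 1 - ‖α‖ ^ 2 := by nlinarith [norm_nonneg α]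
    refine ⟨1 - (1 - ‖α‖ ^ 2) * (1 - r) / 4, by nlinarith, fun u v => ?_⟩
    -- `x = (1 - ᾱ A)⁻¹ (u, v)`, written with the adjugate matrix, and `y = A x`
    set x0 := ((1 - conj α * A.trace) * u + conj α * (A 0 0 * u + A 0 1 * v)) / Q with hx0
    set x1 := ((1 - conj α * A.trace) * v + conj α * (A 1 0 * u + A 1 1 * v)) / Q with hx1
    set y0 := A 0 0 * x0 + A 0 1 * x1 with hy0
    set y1 := A 1 0 * x0 + A 1 1 * x1 with hy1
    have eu : u = x0 - conj α * y0 := by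
      rw [hy0, hx0, hx1]
      field_simp
      rw [hQdef, Matrix.trace_fin_two, Matrix.det_fin_two]
      ring
    have ev : v = x1 - conj α * y1 := by
      rw [hy1, hx0, hx1]
      field_simp
      rw [hQdef, Matrix.trace_fin_two, Matrix.det_fin_two]
      ring
    have eM0 : M 0 0 * u + M 0 1 * v = y0 - α * x0 := by
      simp only [M, Matrix.of_apply, Matrix.cons_val', Matrix.cons_val_zero, Matrix.cons_val_one,
        Matrix.cons_val_fin_one]
      rw [hy0, hx0, hx1]
      field_simp
      rw [hκ, Matrix.trace_fin_two, Matrix.det_fin_two]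
      ring
    have eM1 : M 1 0 * u + M 1 1 * v = y1 - α * x1 := by
      simp only [M, Matrix.of_apply, Matrix.cons_val', Matrix.cons_val_zero, Matrix.cons_val_one,
        Matrix.cons_val_fin_one]
      rw [hy1, hx0, hx1]
      field_simp
      rw [hκ, Matrix.trace_fin_two, Matrix.det_fin_two]
      ring
    rw [eM0, eM1]
    have hxy := h x0 x1
    rw [← hy0, ← hy1] at hxy
    have i0 := norm_sq_mobius α x0 y0
    have i1 := norm_sq_mobius α x1 y1
    have j0 := norm_sq_sub_le α x0 y0 hα.le
    have j1 := norm_sq_sub_le α x1 y1 hα.le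
    rw [← eu] at i0 j0
    rw [← ev] at i1 j1
    have hu : ‖u‖ ^ 2 + ‖v‖ ^ 2 ≤ 4 * (‖x0‖ ^ 2 + ‖x1‖ ^ 2) := by
      nlinarith [sq_nonneg ‖x0‖, sq_nonneg ‖x1‖]
    have h3 : (1 - ‖α‖ ^ 2) * ((1 - r) * (‖u‖ ^ 2 + ‖v‖ ^ 2))
        ≤ (1 - ‖α‖ ^ 2) * (4 * ((‖x0‖ ^ 2 + ‖x1‖ ^ 2) - (‖y0‖ ^ 2 + ‖y1‖ ^ 2))) := by
      refine mul_le_mul_of_nonneg_left ?_ hα2.le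
      nlinarith [mul_le_mul_of_nonneg_left hu (sub_nonneg.2 hr.le)]
    nlinarith
  · ext i
    have hden : mobiusDenom α ![A 1 0, A.trace, A.det] = Q := by simp [mobiusDenom, hQdef]
    rw [pentaMobius, hden]
    fin_cases i
    · simp [M]
    · simp only [M, Fin.mk_one, Fin.isValue, Matrix.cons_val_one, Matrix.cons_val_zero,
        Matrix.trace_fin_two_of, Matrix.cons_val]
      rw [hκ, Matrix.trace_fin_two]
      ring
    · simp only [M, Fin.reduceFinMk, Matrix.cons_val, Matrix.det_fin_two_of]
      rw [div_mul_div_comm, div_mul_div_comm, ← sub_div, div_eq_div_iff hQ (mul_ne_zero hQ hQ),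
        hκ, hQdef, Matrix.trace_fin_two, Matrix.det_fin_two]
      ring

theorem mobiusDenom_neg_pentaMobius {α : ℂ} {w : Fin 3 → ℂ} (hw : mobiusDenom α w ≠ 0) :
    mobiusDenom (-α) (pentaMobius α w) = (1 - α * conj α) ^ 2 / mobiusDenom α w := by
  rw [mobiusDenom]
  simp only [pentaMobius, map_neg, Matrix.cons_val_one, Matrix.cons_val_zero, Matrix.cons_val]
  field_simp
  rw [mobiusDenom]
  ring

theorem one_sub_mul_conj_ne_zero {α : ℂ} (hα : ‖α‖ < 1) : 1 - α * conj α ≠ 0 := by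
  rw [mul_conj_norm]
  have : (1 : ℝ) - ‖α‖ ^ 2 ≠ 0 := by nlinarith [norm_nonneg α]
  exact_mod_cast this

theorem pentaMobius_neg_pentaMobius {α : ℂ} (hα : ‖α‖ < 1) {w : Fin 3 → ℂ}
    (hw : mobiusDenom α w ≠ 0) : pentaMobius (-α) (pentaMobius α w) = w := by
  have h1 := one_sub_mul_conj_ne_zero hα
  have hQ := mobiusDenom_neg_pentaMobius hw
  rw [pentaMobius, hQ]
  ext i
  fin_cases i
  · simp [pentaMobius]
    field_simp
  · simp [pentaMobius]
    field_simp
    rw [mobiusDenom]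
    ring
  · simp [pentaMobius]
    field_simp
    rw [mobiusDenom]
    ring

theorem mobiusDenom_norm_ge {w : Fin 3 → ℂ} (hw : w ∈ pentablock) {α : ℂ} (hα : ‖α‖ ≤ 1) :
    (1 - ‖α‖) ^ 2 ≤ ‖mobiusDenom α w‖ := by
  obtain ⟨A, hA, rfl⟩ := hw
  obtain ⟨l, m, hl, hm, hs, hp⟩ := exists_eigenvalues hA
  have e : mobiusDenom α ![A 1 0, A.trace, A.det] = (1 - conj α * l) * (1 - conj α * m) := by
    simp [mobiusDenom, hs, hp]; ring
  have key : ∀ l : ℂ, ‖l‖ < 1 → 1 - ‖α‖ ≤ ‖1 - conj α * l‖ := by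
    intro l hl
    have := norm_sub_norm_le 1 (conj α * l)
    rw [norm_one, norm_mul, Complex.norm_conj] at this
    nlinarith [norm_nonneg α]
  rw [e, norm_mul, sq]
  exact mul_le_mul (key l hl) (key m hm) (by linarith) (norm_nonneg _)

theorem pentablock_bounds {w : Fin 3 → ℂ} (hw : w ∈ pentablock) :
    ‖w 2‖ < 1 ∧ ‖w 0‖ ^ 2 + ‖w 1‖ ^ 2 / 4 < 1 ∧
      ‖w 1‖ ^ 2 + ‖w 1 ^ 2 - 4 * w 2‖ ≤ 4 := by
  obtain ⟨A, hA, rfl⟩ := hw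
  obtain ⟨l, m, hl, hm, hs, hp⟩ := exists_eigenvalues hA
  refine ⟨?_, ?_, ?_⟩
  · simp only [Matrix.cons_val, hp, norm_mul]
    nlinarith [norm_nonneg l, norm_nonneg m]
  · obtain ⟨r, hr, h⟩ := (mem_matrixBall_iff A).1 hA
    have hcol : ‖A 0 0‖ ^ 2 + ‖A 1 0‖ ^ 2 ≤ r := by simpa using h 1 0
    -- the second row, by applying `A` to its conjugate
    have hrow : ‖A 1 0‖ ^ 2 + ‖A 1 1‖ ^ 2 ≤ r := by
      have h1 := h (conj (A 1 0)) (conj (A 1 1))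
      rw [mul_conj_norm (A 1 0), mul_conj_norm (A 1 1), ← Complex.ofReal_add,
        Complex.norm_real, Real.norm_eq_abs, sq_abs, Complex.norm_conj, Complex.norm_conj] at h1
      by_contra! h2
      have h3 := sq_nonneg ‖A 0 0 * conj (A 1 0) + A 0 1 * conj (A 1 1)‖
      have h4 : 0 ≤ r := le_trans (by positivity) hcol
      nlinarith
    have ht : ‖A.trace‖ ^ 2 ≤ 2 * (‖A 0 0‖ ^ 2 + ‖A 1 1‖ ^ 2) := by
      rw [Matrix.trace_fin_two]
      have := norm_add_le (A 0 0) (A 1 1)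
      nlinarith [norm_nonneg (A 0 0 + A 1 1), sq_nonneg (‖A 0 0‖ - ‖A 1 1‖)]
    simp only [Matrix.cons_val_zero, Matrix.cons_val_one]
    nlinarith
  · simp only [Matrix.cons_val, Matrix.cons_val_one, Matrix.cons_val_zero, hs, hp]
    have e : (l + m) ^ 2 - 4 * (l * m) = (l - m) ^ 2 := by ring
    have := parallelogram_law_with_norm ℝ l m
    rw [e, norm_pow]
    nlinarith [norm_nonneg l, norm_nonneg m]

theorem mem_pentablock_of_eigenvalues {l m : ℂ} (hl : ‖l‖ < 1) (hm : ‖m‖ < 1) :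
    ![0, l + m, l * m] ∈ pentablock :=
  ⟨_, matrixBall_diag hl hm, by simp⟩

/-- The slice of the pentablock by `s = 0` contains the whole bidisc. -/
theorem mem_pentablock_of_trace_zero {a v : ℂ} (ha : ‖a‖ < 1) (hv : ‖v‖ < 1) :
    ![a, 0, v] ∈ pentablock := by
  rcases lt_or_ge ‖v‖ (‖a‖ ^ 2) with h | h
  · have ha0 : a ≠ 0 := by rintro rfl; simp at h; linarith [norm_nonneg v]
    refine ⟨!![0, -v / a; a, 0], ?_, ?_⟩
    · rw [mem_matrixBall_iff]
      have hva : ‖v / a‖ ≤ ‖a‖ := by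
        rw [norm_div, div_le_iff₀ (norm_pos_iff.2 ha0), ← sq]; exact h.le
      refine ⟨‖a‖ ^ 2, by nlinarith [norm_nonneg a], fun u w => ?_⟩
      simp only [Matrix.of_apply, Matrix.cons_val', Matrix.cons_val_zero, Matrix.cons_val_one,
        Matrix.cons_val_fin_one, zero_mul, add_zero, zero_add, norm_mul, mul_pow, neg_div, norm_neg]
      have : ‖v / a‖ ^ 2 ≤ ‖a‖ ^ 2 := by gcongr
      nlinarith [sq_nonneg ‖w‖]
    · ext i; fin_cases i <;> simp [Matrix.trace_fin_two, Matrix.det_fin_two]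
      field_simp
  · -- a multiple of a unitary matrix, whose columns have norm `√|v|`
    obtain ⟨ξ, hξ, hvξ⟩ : ∃ ξ : ℂ, ‖ξ‖ = 1 ∧ v = -ξ ^ 2 * ‖v‖ := by
      obtain ⟨ξ, hξ⟩ := IsAlgClosed.exists_pow_nat_eq
        (-(if v = 0 then 1 else v / ‖v‖)) (n := 2) two_pos
      refine ⟨ξ, ?_, ?_⟩
      · have : ‖ξ‖ ^ 2 = 1 := by
          rw [← norm_pow, hξ, norm_neg]
          split_ifs with h0
          · simp
          · simp [h0]
        nlinarith [norm_nonneg ξ]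
      · rw [hξ]
        split_ifs with h0
        · simp [h0]
        · have : (‖v‖ : ℂ) ≠ 0 := by simpa using h0
          field_simp
    set t : ℝ := √(‖v‖ - ‖a‖ ^ 2) with ht
    have ht2 : t ^ 2 = ‖v‖ - ‖a‖ ^ 2 := Real.sq_sqrt (by linarith)
    have ht2' : (t : ℂ) ^ 2 = ‖v‖ - a * conj a := by
      rw [mul_conj_norm]; exact_mod_cast ht2
    refine ⟨!![t * ξ, ξ ^ 2 * conj a; a, -(t * ξ)], ?_, ?_⟩
    · rw [mem_matrixBall_iff]
      refine ⟨‖v‖, hv, fun u w => le_of_eq ?_⟩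
      simp only [Matrix.of_apply, Matrix.cons_val', Matrix.cons_val_zero, Matrix.cons_val_one,
        Matrix.cons_val_fin_one]
      have hξ2 : ξ.re * ξ.re + ξ.im * ξ.im = 1 := by
        rw [← Complex.normSq_apply, Complex.normSq_eq_norm_sq, hξ, one_pow]
      have e1 : ‖t * ξ * u + ξ ^ 2 * conj a * w‖ = ‖t * u + ξ * conj a * w‖ := by
        rw [show t * ξ * u + ξ ^ 2 * conj a * w = ξ * (t * u + ξ * conj a * w) by ring, norm_mul,
          hξ, one_mul]
      have ha2 : ‖a‖ ^ 2 = a.re * a.re + a.im * a.im := by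
        rw [Complex.sq_norm, Complex.normSq_apply]
      rw [ha2] at ht2
      rw [e1, show ‖v‖ = t ^ 2 + (a.re * a.re + a.im * a.im) by linarith]
      simp only [Complex.sq_norm, Complex.normSq_apply, Complex.add_re, Complex.add_im,
        Complex.neg_re, Complex.neg_im, Complex.mul_re, Complex.mul_im, Complex.conj_re,
        Complex.conj_im, Complex.ofReal_re, Complex.ofReal_im]
      linear_combination ((t ^ 2 + (a.re * a.re + a.im * a.im)) * (w.re * w.re + w.im * w.im)) * hξ2
    · ext i
      fin_cases i
      · simp
      · simp [Matrix.trace_fin_two]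
      · simp only [Fin.reduceFinMk, Matrix.cons_val, Matrix.det_fin_two_of]
        linear_combination hvξ + (ξ ^ 2) * ht2'

/-- `α` is a hyperbolic midpoint of the eigenvalues: the Möbius map with parameter `α` moves them
to opposite points. -/
theorem exists_trace_pentaMobius_eq_zero {w : Fin 3 → ℂ} (hw : w ∈ pentablock) :
    ∃ α : ℂ, ‖α‖ < 1 ∧ pentaMobius α w 1 = 0 := by
  obtain ⟨A, hA, rfl⟩ := hw
  obtain ⟨l, m, hl, hm, hs, hp⟩ := exists_eigenvalues hA
  have hl' := norm_nonneg l
  have hm' := norm_nonneg m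
  have hlm : ‖l‖ * ‖m‖ < 1 := by nlinarith
  set d : ℝ := 1 - ‖l‖ ^ 2 * ‖m‖ ^ 2 with hd
  have hd0 : 0 < d := by nlinarith [mul_nonneg hl' hm']
  have hdC : (d : ℂ) = 1 - (l * conj l) * (m * conj m) := by
    rw [mul_conj_norm, mul_conj_norm]; push_cast [hd]; ring
  have hdC0 : (d : ℂ) ≠ 0 := by exact_mod_cast hd0.ne'
  -- `β` solves `s = β + β̄ p`
  set β : ℂ := ((l + m) - conj (l + m) * (l * m)) / d with hβ
  have hβs : l + m = β + conj β * (l * m) := by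
    rw [hβ]
    simp only [map_div₀, map_sub, map_add, map_mul, Complex.conj_conj, Complex.conj_ofReal]
    field_simp
    rw [hdC]
    ring
  have hβ1 : ‖β‖ < 1 := by
    have e : (l + m) - conj (l + m) * (l * m)
        = l * ((1 - ‖m‖ ^ 2 : ℝ) : ℂ) + m * ((1 - ‖l‖ ^ 2 : ℝ) : ℂ) := by
      push_cast
      have h1 := mul_conj_norm l
      have h2 := mul_conj_norm m
      push_cast at h1 h2
      rw [map_add]
      linear_combination (-m) * h1 - l * h2
    rw [hβ, norm_div, Complex.norm_real, Real.norm_eq_abs, abs_of_pos hd0, div_lt_one hd0, e]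
    refine (norm_add_le _ _).trans_lt ?_
    rw [norm_mul, norm_mul, Complex.norm_real, Complex.norm_real, Real.norm_eq_abs,
      Real.norm_eq_abs, abs_of_nonneg (by nlinarith), abs_of_nonneg (by nlinarith)]
    have h1 : ‖l‖ + ‖m‖ < 1 + ‖l‖ * ‖m‖ := by nlinarith
    have h2 : (1 - ‖l‖ * ‖m‖) * (‖l‖ + ‖m‖) < (1 - ‖l‖ * ‖m‖) * (1 + ‖l‖ * ‖m‖) := by
      gcongr
    nlinarith
  set q : ℝ := √(1 - ‖β‖ ^ 2) with hq
  have hq2 : q ^ 2 = 1 - ‖β‖ ^ 2 := Real.sq_sqrt (by nlinarith [norm_nonneg β])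
  have hq0 : 0 ≤ q := Real.sqrt_nonneg _
  set c : ℝ := 1 / (1 + q) with hc
  have hc0 : 0 < c := by positivity
  have hc1 : c ≤ 1 := by rw [hc, div_le_one (by positivity)]; linarith
  have hceq : 1 - 2 * c + c ^ 2 * ‖β‖ ^ 2 = 0 := by
    rw [show ‖β‖ ^ 2 = 1 - q ^ 2 by linarith, hc]
    field_simp
    ring
  refine ⟨c * β, ?_, ?_⟩
  · rw [norm_mul, Complex.norm_real, Real.norm_eq_abs, abs_of_pos hc0]
    nlinarith [norm_nonneg β]
  · have hceq' : 1 - 2 * (c : ℂ) + c ^ 2 * (β * conj β) = 0 := by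
      rw [mul_conj_norm]; exact_mod_cast hceq
    simp only [pentaMobius, Matrix.cons_val_one, Matrix.cons_val_zero, Matrix.cons_val, map_mul,
      Complex.conj_ofReal, hs, hp]
    rw [div_eq_zero_iff]
    left
    linear_combination (l + m) * hceq' + 2 * c * hβs

/-! ### The closures of the pentablock and of the symmetrized bidisc -/

theorem continuous_vec3 {X : Type*} [TopologicalSpace X] {f g h : X → ℂ} (hf : Continuous f)
    (hg : Continuous g) (hh : Continuous h) : Continuous fun x => ![f x, g x, h x] := by
  refine continuous_pi fun i => ?_
  fin_cases i
  · simpa using hf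
  · simpa using hg
  · simpa using hh

theorem continuous_vec2 {X : Type*} [TopologicalSpace X] {f g : X → ℂ} (hf : Continuous f)
    (hg : Continuous g) : Continuous fun x => ![f x, g x] := by
  refine continuous_pi fun i => ?_
  fin_cases i
  · simpa using hf
  · simpa using hg

theorem vec3_eta (w : Fin 3 → ℂ) : ![w 0, w 1, w 2] = w := by
  ext i; fin_cases i <;> rfl

theorem vec2_eta (z : Fin 2 → ℂ) : ![z 0, z 1] = z := by
  ext i; fin_cases i <;> rfl

theorem closure_pentablock_bounds {w : Fin 3 → ℂ} (hw : w ∈ closure pentablock) :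
    ‖w 2‖ ≤ 1 ∧ ‖w 0‖ ^ 2 + ‖w 1‖ ^ 2 / 4 ≤ 1 ∧
      ‖w 1‖ ^ 2 + ‖w 1 ^ 2 - 4 * w 2‖ ≤ 4 := by
  refine closure_minimal (t := {w : Fin 3 → ℂ | ‖w 2‖ ≤ 1 ∧ ‖w 0‖ ^ 2 + ‖w 1‖ ^ 2 / 4 ≤ 1 ∧
      ‖w 1‖ ^ 2 + ‖w 1 ^ 2 - 4 * w 2‖ ≤ 4}) ?_ ?_ hw
  · intro w hw
    obtain ⟨h1, h2, h3⟩ := pentablock_bounds hw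
    exact ⟨h1.le, h2.le, h3⟩
  · refine IsClosed.and (isClosed_le (by fun_prop) (by fun_prop))
      (IsClosed.and (isClosed_le (by fun_prop) (by fun_prop))
        (isClosed_le (by fun_prop) (by fun_prop)))

theorem mobiusDenom_ne_zero {w : Fin 3 → ℂ} (hw : w ∈ closure pentablock) {α : ℂ}
    (hα : ‖α‖ < 1) : mobiusDenom α w ≠ 0 := by
  have : (1 - ‖α‖) ^ 2 ≤ ‖mobiusDenom α w‖ := by
    refine closure_minimal (t := {w : Fin 3 → ℂ | (1 - ‖α‖) ^ 2 ≤ ‖mobiusDenom α w‖})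
      (fun w hw => mobiusDenom_norm_ge hw hα.le) (isClosed_le (by fun_prop) ?_) hw
    unfold mobiusDenom
    fun_prop
  intro h0
  rw [h0, norm_zero] at this
  nlinarith

theorem differentiableAt_pentaMobius {α : ℂ} {w : Fin 3 → ℂ} (hw : mobiusDenom α w ≠ 0) :
    DifferentiableAt ℂ (pentaMobius α) w := by
  have hd : DifferentiableAt ℂ (mobiusDenom α) w := by
    unfold mobiusDenom
    fun_prop
  rw [differentiableAt_pi]
  intro i
  fin_cases i
  · change DifferentiableAt ℂ (fun w => (1 - α * conj α) * w 0 / mobiusDenom α w) w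
    fun_prop (disch := exact hw)
  · change DifferentiableAt ℂ
      (fun w => ((1 + α * conj α) * w 1 - 2 * conj α * w 2 - 2 * α) / mobiusDenom α w) w
    fun_prop (disch := exact hw)
  · change DifferentiableAt ℂ (fun w => (w 2 - α * w 1 + α ^ 2) / mobiusDenom α w) w
    fun_prop (disch := exact hw)

theorem diffContOnCl_pentaMobius {α : ℂ} (hα : ‖α‖ < 1) :
    DiffContOnCl ℂ (pentaMobius α) pentablock :=
  DifferentiableOn.diffContOnCl fun _ hw =>
    (differentiableAt_pentaMobius (mobiusDenom_ne_zero hw hα)).differentiableWithinAt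

theorem pentaMobius_mem_closure {α : ℂ} (hα : ‖α‖ < 1) {w : Fin 3 → ℂ}
    (hw : w ∈ closure pentablock) : pentaMobius α w ∈ closure pentablock :=
  Set.MapsTo.closure_of_continuousOn (fun _ h => pentaMobius_mem hα h)
    (diffContOnCl_pentaMobius hα).continuousOn hw

theorem mem_closure_pentablock_of_trace_zero {a v : ℂ} (ha : ‖a‖ ≤ 1) (hv : ‖v‖ ≤ 1) :
    ![a, 0, v] ∈ closure pentablock := by
  have h : Set.MapsTo (fun z : ℂ × ℂ => ![z.1, 0, z.2])
      (Metric.ball (0 : ℂ) 1 ×ˢ Metric.ball (0 : ℂ) 1) pentablock := fun z hz =>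
    mem_pentablock_of_trace_zero (by simpa using hz.1) (by simpa using hz.2)
  have h2 := h.closure (continuous_vec3 continuous_fst continuous_const continuous_snd)
  rw [closure_prod_eq, closure_ball _ one_ne_zero] at h2
  exact h2 (x := (a, v)) ⟨by simpa using ha, by simpa using hv⟩

theorem mem_closure_pentablock_of_eigenvalues {l m : ℂ} (hl : ‖l‖ ≤ 1) (hm : ‖m‖ ≤ 1) :
    ![0, l + m, l * m] ∈ closure pentablock := by
  have h : Set.MapsTo (fun z : ℂ × ℂ => ![0, z.1 + z.2, z.1 * z.2])
      (Metric.ball (0 : ℂ) 1 ×ˢ Metric.ball (0 : ℂ) 1) pentablock := fun z hz =>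
    mem_pentablock_of_eigenvalues (by simpa using hz.1) (by simpa using hz.2)
  have h2 := h.closure (continuous_vec3 continuous_const (by fun_prop) (by fun_prop))
  rw [closure_prod_eq, closure_ball _ one_ne_zero] at h2
  exact h2 (x := (l, m)) ⟨by simpa using hl, by simpa using hm⟩

theorem smul_mem_pentablock {r : ℝ} (hr0 : 0 ≤ r) (hr : r ≤ 1) {w : Fin 3 → ℂ}
    (hw : w ∈ pentablock) : ![r * w 0, r * w 1, r ^ 2 * w 2] ∈ pentablock := by
  obtain ⟨A, hA, rfl⟩ := hw
  refine ⟨(r : ℂ) • A, ?_, ?_⟩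
  · have h : ‖Matrix.toEuclideanCLM (𝕜 := ℂ) A‖ < 1 := hA
    change ‖Matrix.toEuclideanCLM (𝕜 := ℂ) ((r : ℂ) • A)‖ < 1
    rw [map_smul, norm_smul, Complex.norm_real, Real.norm_eq_abs, abs_of_nonneg hr0]
    exact (mul_le_of_le_one_left (norm_nonneg _) hr).trans_lt h
  · simp

theorem smul_mem_closure_pentablock {r : ℝ} (hr0 : 0 ≤ r) (hr : r ≤ 1) {w : Fin 3 → ℂ}
    (hw : w ∈ closure pentablock) : ![r * w 0, r * w 1, r ^ 2 * w 2] ∈ closure pentablock :=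
  Set.MapsTo.closure (fun _ h => smul_mem_pentablock hr0 hr h)
    (continuous_vec3 (by fun_prop) (by fun_prop) (by fun_prop)) hw

theorem proj_mem {w : Fin 3 → ℂ} (hw : w ∈ pentablock) : ![w 1, w 2] ∈ symmetrizedBidisc := by
  obtain ⟨A, hA, rfl⟩ := hw
  exact ⟨A, hA, rfl⟩

theorem incl_mem {z : Fin 2 → ℂ} (hz : z ∈ symmetrizedBidisc) : ![0, z 0, z 1] ∈ pentablock := by
  obtain ⟨A, hA, rfl⟩ := hz
  obtain ⟨l, m, hl, hm, hs, hp⟩ := exists_eigenvalues hA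
  have := mem_pentablock_of_eigenvalues hl hm
  rwa [← hs, ← hp] at this

theorem proj_mem_closure {w : Fin 3 → ℂ} (hw : w ∈ closure pentablock) :
    ![w 1, w 2] ∈ closure symmetrizedBidisc :=
  Set.MapsTo.closure (fun _ h => proj_mem h) (continuous_vec2 (by fun_prop) (by fun_prop)) hw

theorem incl_mem_closure {z : Fin 2 → ℂ} (hz : z ∈ closure symmetrizedBidisc) :
    ![0, z 0, z 1] ∈ closure pentablock :=
  Set.MapsTo.closure (fun _ h => incl_mem h)
    (continuous_vec3 (by fun_prop) (by fun_prop) (by fun_prop)) hz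

/-- `r Γ ⊆ 𝔾` for `r < 1`, for the dilation `(s, p) ↦ (r s, r² p)`. -/
theorem smul_incl_mem_pentablock {z : Fin 2 → ℂ} (hz : z ∈ closure symmetrizedBidisc) {r : ℝ}
    (hr0 : 0 ≤ r) (hr : r < 1) : ![0, r * z 0, r ^ 2 * z 1] ∈ pentablock := by
  have hz' := incl_mem_closure hz
  obtain ⟨l, m, hs, hp⟩ := exists_sum_prod (z 0) (z 1)
  have main : ∀ l m : ℂ, z 0 = l + m → z 1 = l * m → ‖l‖ ≤ 1 := by
    intro l m hs hp
    by_contra! hl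
    have hl0 : l ≠ 0 := by rintro rfl; simp at hl; linarith
    refine mobiusDenom_ne_zero hz' (α := (conj l)⁻¹)
      (by rw [norm_inv, Complex.norm_conj]; exact inv_lt_one_of_one_lt₀ hl) ?_
    simp only [mobiusDenom, map_inv₀, Complex.conj_conj, Matrix.cons_val_one, Matrix.cons_val_zero,
      Matrix.cons_val, hs, hp]
    field_simp
    ring
  have scale : ∀ l : ℂ, ‖l‖ ≤ 1 → ‖r * l‖ < 1 := by
    intro l hl
    rw [norm_mul, Complex.norm_real, Real.norm_eq_abs, abs_of_nonneg hr0]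
    nlinarith [norm_nonneg l]
  have h := mem_pentablock_of_eigenvalues (scale l (main l m hs hp))
    (scale m (main m l (by rw [hs, add_comm]) (by rw [hp, mul_comm])))
  convert h using 4
  · rw [hs]; ring
  · rw [hp]; ring

/-! ### The distinguished boundaries -/

/-- A point at which some function of `A(Ω)` peaks lies in the distinguished boundary. -/
theorem mem_distinguishedBoundary_of_peak {d : ℕ} {Ω : Set (Fin d → ℂ)} {k : Fin d → ℂ}
    (hk : k ∈ closure Ω) {f : (Fin d → ℂ) → ℂ} (hf : DiffContOnCl ℂ f Ω)
    (hpeak : ∀ w ∈ closure Ω, ‖f k‖ ≤ ‖f w‖ → w = k) : k ∈ distinguishedBoundary Ω := by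
  rintro C ⟨-, hC, hmax⟩
  obtain ⟨c, hc, h⟩ := hmax f hf
  rw [← hpeak c (hC hc) (h k hk)]
  exact hc

/-- The set `{(a, s, p) : |p| = 1, s = s̄ p, |a|² + |s|² / 4 = 1}`, shown below to be `b𝒫`. -/
def pentaShilov : Set (Fin 3 → ℂ) :=
  {w | ‖w 2‖ = 1 ∧ w 1 = conj (w 1) * w 2 ∧ ‖w 0‖ ^ 2 = 1 - ‖w 1‖ ^ 2 / 4}

/-- The set `{(s, p) : |p| = 1, s = s̄ p, |s| ≤ 2}`, shown below to be `bΓ`. -/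
def gammaShilov : Set (Fin 2 → ℂ) :=
  {z | ‖z 1‖ = 1 ∧ z 0 = conj (z 0) * z 1 ∧ ‖z 0‖ ≤ 2}

theorem proj_mem_gammaShilov {w : Fin 3 → ℂ} (hw : w ∈ pentaShilov) :
    ![w 1, w 2] ∈ gammaShilov := by
  obtain ⟨h1, h2, h3⟩ := hw
  exact ⟨by simpa using h1, by simpa using h2, by
    simp only [Matrix.cons_val_zero]
    nlinarith [sq_nonneg ‖w 0‖, norm_nonneg (w 1)]⟩

theorem mul_conj_eq_one {z : ℂ} (hz : ‖z‖ = 1) : z * conj z = 1 := by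
  rw [mul_conj_norm, hz]; simp

theorem isClosed_pentaShilov : IsClosed pentaShilov := by
  refine IsClosed.and (isClosed_eq (by fun_prop) (by fun_prop))
    (IsClosed.and (isClosed_eq (by fun_prop) ?_) (isClosed_eq (by fun_prop) (by fun_prop)))
  exact (Complex.continuous_conj.comp (continuous_apply 1)).mul (continuous_apply 2)

theorem isClosed_gammaShilov : IsClosed gammaShilov := by
  refine IsClosed.and (isClosed_eq (by fun_prop) (by fun_prop))
    (IsClosed.and (isClosed_eq (by fun_prop) ?_) (isClosed_le (by fun_prop) (by fun_prop)))
  exact (Complex.continuous_conj.comp (continuous_apply 0)).mul (continuous_apply 1)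

theorem isCompact_pentaShilov : IsCompact pentaShilov := by
  refine (isCompact_closedBall (0 : Fin 3 → ℂ) 2).of_isClosed_subset isClosed_pentaShilov ?_
  rintro w ⟨h1, -, h3⟩
  rw [mem_closedBall_zero_iff, pi_norm_le_iff_of_nonneg zero_le_two]
  have := norm_nonneg (w 0)
  have := norm_nonneg (w 1)
  intro i
  fin_cases i
  · change ‖w 0‖ ≤ 2
    nlinarith
  · change ‖w 1‖ ≤ 2
    nlinarith
  · change ‖w 2‖ ≤ 2
    linarith

theorem pentaMobius_mem_pentaShilov {α u v : ℂ} (hα : ‖α‖ < 1) (hu : ‖u‖ = 1) (hv : ‖v‖ = 1) :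
    pentaMobius α ![u, 0, v] ∈ pentaShilov := by
  have hQ := mobiusDenom_ne_zero (mem_closure_pentablock_of_trace_zero hu.le hv.le) hα
  have hQe : mobiusDenom α ![u, 0, v] = 1 + conj α ^ 2 * v := by simp [mobiusDenom]
  set Q := mobiusDenom α ![u, 0, v] with hQdef
  have hvv := mul_conj_eq_one hv
  have hQc : conj Q = conj v * (v + α ^ 2) := by
    rw [hQe]
    simp only [map_add, map_one, map_mul, map_pow, Complex.conj_conj]
    linear_combination (-1 : ℂ) * hvv
  have hQc0 : conj Q ≠ 0 := by simpa using hQ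
  have hQn : ‖v + α ^ 2‖ = ‖Q‖ := by
    rw [← Complex.norm_conj Q, hQc, norm_mul, Complex.norm_conj, hv, one_mul]
  have e0 : pentaMobius α ![u, 0, v] 0 = (1 - α * conj α) * u / Q := by
    simp [pentaMobius, hQdef]
  have e1 : pentaMobius α ![u, 0, v] 1 = (-2 * conj α * v - 2 * α) / Q := by
    simp [pentaMobius, hQdef]
  have e2 : pentaMobius α ![u, 0, v] 2 = (v + α ^ 2) / Q := by
    simp [pentaMobius, hQdef]
  refine ⟨?_, ?_, ?_⟩
  · rw [e2, norm_div, hQn, div_self (norm_ne_zero_iff.2 hQ)]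
  · rw [e1, e2]
    simp only [map_div₀, map_sub, map_mul, map_neg, map_ofNat, Complex.conj_conj]
    rw [div_mul_div_comm, div_eq_div_iff hQ (mul_ne_zero hQc0 hQ), hQc]
    linear_combination (-2 * conj α * (v + α ^ 2) * Q) * hvv
  · have hu2 : ‖(1 - α * conj α) * u‖ ^ 2 = (1 - ‖α‖ ^ 2) ^ 2 := by
      rw [norm_mul, hu, mul_one, mul_conj_norm,
        show (1 : ℂ) - ((‖α‖ ^ 2 : ℝ) : ℂ) = ((1 - ‖α‖ ^ 2 : ℝ) : ℂ) by push_cast; ring,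
        Complex.norm_real, Real.norm_eq_abs, sq_abs]
    have hQ2 : 0 < ‖Q‖ ^ 2 := by positivity
    have hv2 : v.re * v.re + v.im * v.im = 1 := by
      rw [← Complex.normSq_apply, Complex.normSq_eq_norm_sq, hv, one_pow]
    rw [e0, e1, norm_div, norm_div, div_pow, div_pow, hu2, eq_sub_iff_add_eq]
    field_simp
    rw [hQe]
    simp only [Complex.sq_norm, Complex.normSq_apply]
    simp only [pow_two, Complex.add_re, Complex.add_im,
      Complex.sub_re, Complex.sub_im, Complex.neg_re, Complex.neg_im, Complex.re_ofNat,
      Complex.im_ofNat, Complex.mul_re, Complex.mul_im, Complex.conj_re,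
      Complex.conj_im, Complex.one_re, Complex.one_im]
    linear_combination (4 * (α.re * α.re + α.im * α.im)
      - 4 * (α.re * α.re + α.im * α.im) ^ 2) * hv2

/-- Every point of `pentaShilov` with `|s| < 2` is moved by a Möbius map to the slice `s = 0`. -/
theorem exists_eq_pentaMobius {k : Fin 3 → ℂ} (hk : k ∈ pentaShilov) (hs : ‖k 1‖ < 2) :
    ∃ α u v : ℂ, ‖α‖ < 1 ∧ ‖u‖ = 1 ∧ ‖v‖ = 1 ∧ k = pentaMobius α ![u, 0, v] := by
  obtain ⟨h2, h1, h0⟩ := hk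
  set q : ℝ := √(4 - ‖k 1‖ ^ 2) with hq
  have hpos : 0 < 4 - ‖k 1‖ ^ 2 := by nlinarith [norm_nonneg (k 1)]
  have hq0 : 0 < q := Real.sqrt_pos.2 hpos
  have hq2 : q ^ 2 = 4 - ‖k 1‖ ^ 2 := Real.sq_sqrt hpos.le
  have hqC : (q : ℂ) ^ 2 = 4 - k 1 * conj (k 1) := by
    rw [mul_conj_norm]; exact_mod_cast hq2
  have hq0C : (q : ℂ) ≠ 0 := by exact_mod_cast hq0.ne'
  have hq2C : (2 + q : ℂ) ≠ 0 := by
    have : (2 + q : ℝ) ≠ 0 := by positivity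
    exact_mod_cast this
  have hα : ‖-k 1 / (2 + q : ℂ)‖ < 1 := by
    rw [norm_div, norm_neg, show (2 + q : ℂ) = ((2 + q : ℝ) : ℂ) by push_cast; ring,
      Complex.norm_real, Real.norm_eq_abs, abs_of_pos (by positivity), div_lt_one (by positivity)]
    linarith
  have hu : ‖2 * k 0 / (q : ℂ)‖ = 1 := by
    rw [norm_div, norm_mul, Complex.norm_real, Real.norm_eq_abs, abs_of_pos hq0,
      div_eq_one_iff_eq hq0.ne', Complex.norm_ofNat]
    rw [← sq_eq_sq₀ (by positivity) hq0.le]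
    nlinarith
  refine ⟨-k 1 / (2 + q : ℂ), 2 * k 0 / (q : ℂ), k 2, hα, hu, h2, ?_⟩
  have hc : conj (-k 1 / (2 + q : ℂ)) = -conj (k 1) / (2 + q) := by
    rw [map_div₀, map_neg, map_add, map_ofNat, Complex.conj_ofReal]
  have hss : conj (k 1) ^ 2 * k 2 = k 1 * conj (k 1) := by
    linear_combination (-conj (k 1)) * h1
  have hss' : k 1 ^ 2 = k 1 * conj (k 1) * k 2 := by
    linear_combination (k 1) * h1
  have hQ : mobiusDenom (-k 1 / (2 + q : ℂ)) ![2 * k 0 / (q : ℂ), 0, k 2] = 4 / (2 + q) := by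
    simp only [mobiusDenom, hc, Matrix.cons_val_one, Matrix.cons_val_zero, Matrix.cons_val]
    field_simp
    linear_combination hss + hqC
  rw [pentaMobius, hQ, hc]
  have h4 : (4 : ℂ) / (2 + q) ≠ 0 := div_ne_zero (by norm_num) hq2C
  ext i
  fin_cases i
  · simp
    rw [eq_div_iff h4]
    field_simp
    linear_combination (2 * k 0) * hqC
  · simp
    rw [eq_div_iff h4]
    field_simp
    linear_combination (2 : ℂ) * h1
  · simp
    rw [eq_div_iff h4]
    field_simp
    linear_combination (-1 : ℂ) * hss' - k 2 * hqC

theorem eq_of_norm_eq_two {k : Fin 3 → ℂ} (hk : k ∈ pentaShilov) (hs : ‖k 1‖ = 2) :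
    k = ![0, k 1 / 2 + k 1 / 2, k 1 / 2 * (k 1 / 2)] := by
  obtain ⟨h2, h1, h0⟩ := hk
  have hk0 : k 0 = 0 := by
    rw [hs] at h0
    norm_num at h0
    exact h0
  have h4 : k 1 * conj (k 1) = 4 := by
    rw [mul_conj_norm, hs]; norm_num
  ext i
  fin_cases i
  · simpa using hk0
  · simp
  · simp
    linear_combination (-k 1 / 4) * h1 - (k 2 / 4) * h4

theorem norm_le_two_of_mem_pentaShilov {k : Fin 3 → ℂ} (hk : k ∈ pentaShilov) : ‖k 1‖ ≤ 2 := by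
  obtain ⟨-, -, h0⟩ := hk
  nlinarith [sq_nonneg ‖k 0‖, norm_nonneg (k 1)]

theorem pentaShilov_subset_closure : pentaShilov ⊆ closure pentablock := by
  intro k hk
  rcases (norm_le_two_of_mem_pentaShilov hk).lt_or_eq with hs | hs
  · obtain ⟨α, u, v, hα, hu, hv, rfl⟩ := exists_eq_pentaMobius hk hs
    exact pentaMobius_mem_closure hα (mem_closure_pentablock_of_trace_zero hu.le hv.le)
  · rw [eq_of_norm_eq_two hk hs]
    have : ‖k 1 / 2‖ ≤ 1 := by rw [norm_div, hs]; norm_num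
    exact mem_closure_pentablock_of_eigenvalues this this

theorem norm_sq_mobius_one (a z : ℂ) :
    ‖1 + conj a * z‖ ^ 2 - ‖z + a‖ ^ 2 = (1 - ‖a‖ ^ 2) * (1 - ‖z‖ ^ 2) := by
  have := norm_sq_mobius (-a) 1 z
  simpa using this

theorem one_add_conj_mul_ne_zero {a z : ℂ} (ha : ‖a‖ < 1) (hz : ‖z‖ ≤ 1) :
    1 + conj a * z ≠ 0 := by
  intro h0
  have h : conj a * z = -1 := by linear_combination h0
  have h1 : ‖a‖ * ‖z‖ = 1 := by
    rw [← Complex.norm_conj a, ← norm_mul, h, norm_neg, norm_one]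
  nlinarith [norm_nonneg a, norm_nonneg z]

theorem norm_mobius_lt_one {a z : ℂ} (ha : ‖a‖ < 1) (hz : ‖z‖ < 1) :
    ‖(z + a) / (1 + conj a * z)‖ < 1 := by
  have h0 := norm_pos_iff.2 (one_add_conj_mul_ne_zero ha hz.le)
  rw [norm_div, div_lt_one h0]
  have := norm_sq_mobius_one a z
  have : 0 < (1 - ‖a‖ ^ 2) * (1 - ‖z‖ ^ 2) := by
    apply mul_pos <;> nlinarith [norm_nonneg a, norm_nonneg z]
  exact lt_of_pow_lt_pow_left₀ 2 h0.le (by linarith)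

theorem norm_mobius_eq_one {a z : ℂ} (ha : ‖a‖ < 1) (hz : ‖z‖ = 1) :
    ‖(z + a) / (1 + conj a * z)‖ = 1 := by
  have h0 := norm_pos_iff.2 (one_add_conj_mul_ne_zero ha hz.le)
  rw [norm_div, div_eq_one_iff_eq h0.ne']
  have := norm_sq_mobius_one a z
  rw [hz] at this
  rw [← sq_eq_sq₀ (norm_nonneg _) h0.le]
  linarith

/-- Through every point of the pentablock passes an analytic disc with boundary in
`pentaShilov`: a Möbius map reduces this to the points `(a, 0, v)` with `|a|, |v| < 1`. -/
theorem isBoundary_pentaShilov : IsBoundary pentablock pentaShilov := by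
  refine ⟨pentaShilov_subset_closure, fun f hf => ?_⟩
  have hne : pentaShilov.Nonempty := ⟨![1, 0, 1], by simp [pentaShilov]⟩
  obtain ⟨c, hc, hmax⟩ := isCompact_pentaShilov.exists_isMaxOn hne
    (hf.continuousOn.mono pentaShilov_subset_closure).norm
  refine ⟨c, hc, fun w hw => le_on_closure (fun w hw => ?_) hf.continuousOn.norm
    continuousOn_const hw⟩
  obtain ⟨α, hα, h0⟩ := exists_trace_pentaMobius_eq_zero hw
  have hM := pentaMobius_mem hα hw
  obtain ⟨hv, ha, -⟩ := pentablock_bounds hM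
  set a := pentaMobius α w 0 with hadef
  set v := pentaMobius α w 2 with hvdef
  have ha : ‖a‖ < 1 := by
    rw [h0] at ha
    simp only [norm_zero] at ha
    nlinarith [norm_nonneg a]
  have hα' : ‖-α‖ < 1 := by simpa using hα
  have hwe : pentaMobius (-α) ![a, 0, v] = w := by
    rw [← h0, hadef, hvdef, vec3_eta]
    exact pentaMobius_neg_pentaMobius hα (mobiusDenom_ne_zero (subset_closure hw) hα)
  set h : ℂ → Fin 3 → ℂ := fun z => ![(z + a) / (1 + conj a * z), 0, (z + v) / (1 + conj v * z)]
    with hh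
  have hdiff : DiffContOnCl ℂ h (Metric.ball 0 1) := by
    refine DifferentiableOn.diffContOnCl fun z hz => DifferentiableAt.differentiableWithinAt ?_
    rw [closure_ball _ one_ne_zero, mem_closedBall_zero_iff] at hz
    rw [differentiableAt_pi]
    intro i
    fin_cases i
    · exact DifferentiableAt.div (by fun_prop) (by fun_prop) (one_add_conj_mul_ne_zero ha hz)
    · exact differentiableAt_const _
    · exact DifferentiableAt.div (by fun_prop) (by fun_prop) (one_add_conj_mul_ne_zero hv hz)
  have hmaps : Set.MapsTo h (Metric.ball 0 1) pentablock := fun z hz => by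
    rw [mem_ball_zero_iff] at hz
    exact mem_pentablock_of_trace_zero (norm_mobius_lt_one ha hz) (norm_mobius_lt_one hv hz)
  have hF := hf.comp ((diffContOnCl_pentaMobius hα').comp hdiff hmaps)
    (fun z hz => pentaMobius_mem hα' (hmaps hz))
  have key := Complex.norm_le_of_forall_mem_frontier_norm_le Metric.isBounded_ball hF
    (C := ‖f c‖) (fun z hz => ?_) (z := 0) (by
      rw [closure_ball _ one_ne_zero]; simp)
  · have h00 : h 0 = ![a, 0, v] := by simp [hh]
    simp only [Function.comp_apply, h00, hwe] at key
    exact key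
  · rw [frontier_ball _ one_ne_zero, mem_sphere_zero_iff_norm] at hz
    exact hmax (pentaMobius_mem_pentaShilov hα' (norm_mobius_eq_one ha hz)
      (norm_mobius_eq_one hv hz))

theorem eq_of_norm_add_ge {s t : ℂ} {r : ℝ} (hs : ‖s‖ ≤ r) (ht : ‖t‖ ≤ r)
    (h : 2 * r ≤ ‖s + t‖) : s = t := by
  have hp := parallelogram_law_with_norm ℝ s t
  have h0 : ‖s - t‖ * ‖s - t‖ ≤ 0 := by
    nlinarith [norm_nonneg s, norm_nonneg t, norm_nonneg (s + t)]
  have : ‖s - t‖ = 0 := by nlinarith [norm_nonneg (s - t)]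
  exact sub_eq_zero.1 (norm_eq_zero.1 this)

theorem eq_of_conj_mul_eq_one {u a : ℂ} (hu : ‖u‖ = 1) (h : 1 = conj u * a) : a = u := by
  linear_combination (-a) * mul_conj_eq_one hu - u * h

theorem proj_diffContOnCl : DiffContOnCl ℂ (fun w : Fin 3 → ℂ => ![w 1, w 2]) pentablock := by
  refine Differentiable.diffContOnCl ?_
  rw [differentiable_pi]
  intro i
  fin_cases i
  · exact differentiable_apply (1 : Fin 3)
  · exact differentiable_apply (2 : Fin 3)

theorem incl_diffContOnCl :
    DiffContOnCl ℂ (fun z : Fin 2 → ℂ => ![0, z 0, z 1]) symmetrizedBidisc := by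
  refine Differentiable.diffContOnCl ?_
  rw [differentiable_pi]
  intro i
  fin_cases i
  · exact differentiable_const _
  · exact differentiable_apply (0 : Fin 2)
  · exact differentiable_apply (1 : Fin 2)

/-- Only the scalar matrix `s / 2` is a contraction with trace `s` if `|s| = 2`. -/
theorem eq_of_trace_eq {w : Fin 3 → ℂ} (hw : w ∈ closure pentablock) {s : ℂ} (hs : ‖s‖ = 2)
    (h : w 1 = s) : w = ![0, s / 2 + s / 2, s / 2 * (s / 2)] := by
  obtain ⟨-, h0, h1⟩ := closure_pentablock_bounds hw
  rw [h, hs] at h0 h1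
  have hw0 : w 0 = 0 := by
    have : ‖w 0‖ ^ 2 = 0 := by nlinarith [sq_nonneg ‖w 0‖]
    simpa using this
  have hw2 : s ^ 2 - 4 * w 2 = 0 := by
    rw [← norm_eq_zero]
    nlinarith [norm_nonneg (s ^ 2 - 4 * w 2)]
  ext i
  fin_cases i
  · simpa using hw0
  · simpa using h
  · simp
    linear_combination (-1 / 4 : ℂ) * hw2

theorem norm_trace_le_two {w : Fin 3 → ℂ} (hw : w ∈ closure pentablock) : ‖w 1‖ ≤ 2 := by
  obtain ⟨-, h0, -⟩ := closure_pentablock_bounds hw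
  nlinarith [sq_nonneg ‖w 0‖, norm_nonneg (w 1)]

theorem eq_trace_of_peak {w : Fin 3 → ℂ} (hw : w ∈ closure pentablock) {s : ℂ} (hs : ‖s‖ = 2)
    (h : ‖s + s‖ ≤ ‖w 1 + s‖) : w 1 = s := by
  refine eq_of_norm_add_ge (norm_trace_le_two hw) hs.le ?_
  rw [← two_mul, norm_mul, hs] at h
  simpa using h

/-- The peak functions are `s + s₀` if `|s₀| = 2`, and otherwise, after a Möbius map taking the
point to `(u, 0, v)`, the function `(1 + ū a) (1 + v̄ p)`. -/
theorem pentaShilov_subset_distinguishedBoundary :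
    pentaShilov ⊆ distinguishedBoundary pentablock := by
  intro k hk
  have hkc := pentaShilov_subset_closure hk
  rcases (norm_le_two_of_mem_pentaShilov hk).lt_or_eq with hs | hs
  · obtain ⟨α, u, v, hα, hu, hv, rfl⟩ := exists_eq_pentaMobius hk hs
    have hα' : ‖-α‖ < 1 := by simpa using hα
    have hg : Differentiable ℂ fun w : Fin 3 → ℂ => (1 + conj u * w 0) * (1 + conj v * w 2) := by
      fun_prop
    have hf := hg.comp_diffContOnCl (diffContOnCl_pentaMobius hα')
    refine mem_distinguishedBoundary_of_peak hkc hf fun w hw hle => ?_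
    simp only [Function.comp_apply] at hle
    have huv := mem_closure_pentablock_of_trace_zero hu.le hv.le
    rw [pentaMobius_neg_pentaMobius hα (mobiusDenom_ne_zero huv hα)] at hle
    obtain ⟨b2, b0, -⟩ := closure_pentablock_bounds (pentaMobius_mem_closure hα' hw)
    have hback := pentaMobius_neg_pentaMobius hα' (mobiusDenom_ne_zero hw hα')
    rw [neg_neg] at hback
    set m := pentaMobius (-α) w with hm
    have hu1 : conj u * u = 1 := by rw [mul_comm]; exact mul_conj_eq_one hu
    have hv1 : conj v * v = 1 := by rw [mul_comm]; exact mul_conj_eq_one hv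
    have hL : ‖(1 + conj u * (![u, 0, v] : Fin 3 → ℂ) 0)
        * (1 + conj v * (![u, 0, v] : Fin 3 → ℂ) 2)‖ = 4 := by
      simp only [Matrix.cons_val_zero, Matrix.cons_val, hu1, hv1]
      norm_num
    rw [hL, norm_mul] at hle
    have c0 : ‖conj u * m 0‖ ≤ 1 := by
      rw [norm_mul, Complex.norm_conj, hu, one_mul]
      nlinarith [norm_nonneg (m 0), sq_nonneg ‖m 1‖]
    have c2 : ‖conj v * m 2‖ ≤ 1 := by
      rw [norm_mul, Complex.norm_conj, hv, one_mul]
      exact b2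
    have d0 : ‖1 + conj u * m 0‖ ≤ 2 := (norm_add_le _ _).trans (by rw [norm_one]; linarith)
    have d2 : ‖1 + conj v * m 2‖ ≤ 2 := (norm_add_le _ _).trans (by rw [norm_one]; linarith)
    have f0 : 2 ≤ ‖1 + conj u * m 0‖ := by nlinarith [norm_nonneg (1 + conj u * m 0)]
    have f2 : 2 ≤ ‖1 + conj v * m 2‖ := by nlinarith [norm_nonneg (1 + conj v * m 2)]
    have g0 : m 0 = u := eq_of_conj_mul_eq_one hu
      (eq_of_norm_add_ge norm_one.le c0 (by linarith))
    have g2 : m 2 = v := eq_of_conj_mul_eq_one hv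
      (eq_of_norm_add_ge norm_one.le c2 (by linarith))
    have g1 : m 1 = 0 := by
      rw [g0, hu] at b0
      have : ‖m 1‖ ^ 2 = 0 := by nlinarith [sq_nonneg ‖m 1‖]
      simpa using this
    rw [← hback, ← vec3_eta m, g0, g1, g2]
  · refine mem_distinguishedBoundary_of_peak hkc (f := fun w => w 1 + k 1)
      (Differentiable.diffContOnCl (by fun_prop)) fun w hw hle => ?_
    rw [eq_of_trace_eq hw hs (eq_trace_of_peak hw hs hle), ← eq_of_trace_eq hkc hs rfl]

theorem distinguishedBoundary_pentablock : distinguishedBoundary pentablock = pentaShilov :=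
  Set.Subset.antisymm (Set.sInter_subset_of_mem ⟨isClosed_pentaShilov, isBoundary_pentaShilov⟩)
    pentaShilov_subset_distinguishedBoundary

theorem exists_mem_pentaShilov {z : Fin 2 → ℂ} (hz : z ∈ gammaShilov) :
    ∃ a : ℂ, ![a, z 0, z 1] ∈ pentaShilov := by
  obtain ⟨h1, h2, h3⟩ := hz
  refine ⟨(√(1 - ‖z 0‖ ^ 2 / 4) : ℝ), by simpa using h1, by simpa using h2, ?_⟩
  simp only [Matrix.cons_val_zero, Matrix.cons_val_one]
  rw [Complex.norm_real, Real.norm_eq_abs, sq_abs, Real.sq_sqrt]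
  nlinarith [norm_nonneg (z 0)]

theorem isBoundary_gammaShilov : IsBoundary symmetrizedBidisc gammaShilov := by
  refine ⟨fun z hz => ?_, fun f hf => ?_⟩
  · obtain ⟨a, ha⟩ := exists_mem_pentaShilov hz
    rw [← vec2_eta z]
    exact proj_mem_closure (pentaShilov_subset_closure ha)
  · obtain ⟨c, hc, h⟩ := isBoundary_pentaShilov.2 _
      (hf.comp proj_diffContOnCl (fun _ hw => proj_mem hw))
    refine ⟨![c 1, c 2], proj_mem_gammaShilov hc, fun z hz => ?_⟩
    rw [← vec2_eta z]
    exact h _ (incl_mem_closure hz)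

/-- The peak functions are `s + s₀` if `|s₀| = 2`, and otherwise, after a Möbius map taking the
point to `(0, v)`, the function `4 + v̄ (4 p - s²)`. -/
theorem gammaShilov_subset_distinguishedBoundary :
    gammaShilov ⊆ distinguishedBoundary symmetrizedBidisc := by
  intro z hz
  have hzc := isBoundary_gammaShilov.1 hz
  obtain ⟨a, ha⟩ := exists_mem_pentaShilov hz
  rcases hz.2.2.lt_or_eq with hs | hs
  · obtain ⟨α, u, v, hα, hu, hv, hk⟩ := exists_eq_pentaMobius ha hs
    have hα' : ‖-α‖ < 1 := by simpa using hα
    have hg : Differentiable ℂ fun w : Fin 3 → ℂ => 4 + conj v * (4 * w 2 - w 1 ^ 2) := by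
      fun_prop
    have hf := hg.comp_diffContOnCl ((diffContOnCl_pentaMobius hα').comp incl_diffContOnCl
      (fun _ h => incl_mem h))
    -- the last two coordinates of `pentaMobius` do not depend on the first variable
    have indep : ∀ (β b b' s p : ℂ), pentaMobius β ![b, s, p] 1 = pentaMobius β ![b', s, p] 1 ∧
        pentaMobius β ![b, s, p] 2 = pentaMobius β ![b', s, p] 2 := by
      intro β b b' s p
      simp [pentaMobius, mobiusDenom]
    have huv := mem_closure_pentablock_of_trace_zero hu.le hv.le
    have hz0 : pentaMobius (-α) ![a, z 0, z 1] = ![u, 0, v] := by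
      rw [hk]
      exact pentaMobius_neg_pentaMobius hα (mobiusDenom_ne_zero huv hα)
    have z1 : pentaMobius (-α) ![0, z 0, z 1] 1 = 0 := by
      rw [(indep (-α) 0 a _ _).1, hz0]; rfl
    have z2 : pentaMobius (-α) ![0, z 0, z 1] 2 = v := by
      rw [(indep (-α) 0 a _ _).2, hz0]; rfl
    refine mem_distinguishedBoundary_of_peak hzc hf fun y hy hle => ?_
    simp only [Function.comp_apply, z1, z2] at hle
    have hyc := incl_mem_closure hy
    obtain ⟨-, -, b⟩ := closure_pentablock_bounds (pentaMobius_mem_closure hα' hyc)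
    have hback := pentaMobius_neg_pentaMobius hα' (mobiusDenom_ne_zero hyc hα')
    rw [neg_neg] at hback
    set m := pentaMobius (-α) ![0, y 0, y 1] with hm
    have hv1 : conj v * v = 1 := by rw [mul_comm]; exact mul_conj_eq_one hv
    have hL : ‖4 + conj v * (4 * v - 0 ^ 2)‖ = 8 := by
      rw [show 4 + conj v * (4 * v - 0 ^ 2) = (8 : ℂ) by linear_combination 4 * hv1]
      norm_num
    rw [hL] at hle
    have hc : ‖conj v * (4 * m 2 - m 1 ^ 2)‖ = ‖m 1 ^ 2 - 4 * m 2‖ := by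
      rw [norm_mul, Complex.norm_conj, hv, one_mul, norm_sub_rev]
    have hge : 8 ≤ 4 + ‖m 1 ^ 2 - 4 * m 2‖ := by
      refine hle.trans ((norm_add_le _ _).trans ?_)
      rw [hc]
      norm_num
    have g1 : m 1 = 0 := by
      have : ‖m 1‖ ^ 2 = 0 := by nlinarith [sq_nonneg ‖m 1‖]
      simpa using this
    have g2 : m 2 = v := by
      refine eq_of_conj_mul_eq_one hv ?_
      have := eq_of_norm_add_ge (s := 4) (t := conj v * (4 * m 2 - m 1 ^ 2)) (r := 4) (by norm_num)
        (by rw [hc]; nlinarith [sq_nonneg ‖m 1‖]) (by linarith)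
      rw [g1] at this
      linear_combination (1 / 4 : ℂ) * this
    have hk' : pentaMobius α ![0, 0, v] = ![0, y 0, y 1] := by
      rw [← hback, ← vec3_eta m, g1, g2]
      congr 2
      rw [hm]
      simp [pentaMobius]
    have k0 : y 0 = z 0 := by
      have e1 := congrFun hk' 1
      have e2 := congrFun hk 1
      rw [(indep α 0 u 0 v).1, ← e2] at e1
      simpa using e1.symm
    have k1 : y 1 = z 1 := by
      have e1 := congrFun hk' 2
      have e2 := congrFun hk 2
      rw [(indep α 0 u 0 v).2, ← e2] at e1
      simpa using e1.symm
    ext i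
    fin_cases i
    · exact k0
    · exact k1
  · refine mem_distinguishedBoundary_of_peak hzc (f := fun y => y 0 + z 0)
      (Differentiable.diffContOnCl (by fun_prop)) fun y hy hle => ?_
    have hyc := incl_mem_closure hy
    have e1 := eq_of_trace_eq hyc hs (eq_trace_of_peak hyc hs hle)
    have e2 := eq_of_trace_eq (incl_mem_closure hzc) hs rfl
    have e := e1.trans e2.symm
    ext i
    fin_cases i
    · exact congrFun e 1
    · exact congrFun e 2

theorem distinguishedBoundary_symmetrizedBidisc :
    distinguishedBoundary symmetrizedBidisc = gammaShilov :=
  Set.Subset.antisymm (Set.sInter_subset_of_mem ⟨isClosed_gammaShilov, isBoundary_gammaShilov⟩)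
    gammaShilov_subset_distinguishedBoundary

/-! ### Polynomials on the unit circle -/

theorem infinite_norm_eq_one : {z : ℂ | ‖z‖ = 1}.Infinite := by
  have h : (Metric.sphere (0 : ℂ) 1).Infinite := by
    refine IsPreconnected.infinite_of_nontrivial
      (isPreconnected_sphere (by rw [Complex.rank_real_complex]; norm_num) 0 1) ⟨1, ?_, -1, ?_, ?_⟩
    · simp
    · simp
    · norm_num
  refine h.mono fun z hz => ?_
  simpa using hz

theorem eq_of_eval_eq_on_circle {p q : ℂ[X]} (h : ∀ z, ‖z‖ = 1 → p.eval z = q.eval z) : p = q :=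
  Polynomial.eq_of_infinite_eval_eq p q (infinite_norm_eq_one.mono fun z hz => h z hz)

theorem conjReverse_eval_circle {n : ℕ} {f : ℂ[X]} (hf : f.natDegree ≤ n) {z : ℂ} (hz : ‖z‖ = 1) :
    (conjReverse n f).eval z = z ^ n * conj (f.eval z) := by
  have hz0 : z ≠ 0 := by rintro rfl; simp at hz
  have h1 : 1 / conj z = z := by
    have h := mul_conj_eq_one hz
    have : conj z ≠ 0 := by simpa using hz0
    field_simp
    linear_combination -h
  rw [conjReverse_eval n f hf z hz0, h1]

theorem mul_conjReverse_eval_circle {n : ℕ} {f : ℂ[X]} (hf : f.natDegree ≤ n) {z : ℂ}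
    (hz : ‖z‖ = 1) : f.eval z * (conjReverse n f).eval z = z ^ n * ((‖f.eval z‖ ^ 2 : ℝ) : ℂ) := by
  rw [conjReverse_eval_circle hf hz, ← mul_conj_norm]
  ring

theorem natDegree_conjReverse_le {n : ℕ} {f : ℂ[X]} (hf : f.natDegree ≤ n) :
    (conjReverse n f).natDegree ≤ n := by
  rw [Polynomial.natDegree_le_iff_coeff_eq_zero]
  intro i hi
  rw [conjReverse, Polynomial.coeff_reflect, Polynomial.revAt_eq_self_of_lt hi,
    Polynomial.coeff_map, Polynomial.coeff_eq_zero_of_natDegree_lt (hf.trans_lt hi), map_zero]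

theorem natDegree_conjReverse {n : ℕ} {f : ℂ[X]} (hf : f.natDegree ≤ n) (h0 : f.eval 0 ≠ 0) :
    (conjReverse n f).natDegree = n := by
  refine le_antisymm (natDegree_conjReverse_le hf) (Polynomial.le_natDegree_of_ne_zero ?_)
  rw [conjReverse, Polynomial.coeff_reflect, Polynomial.revAt_le le_rfl, Nat.sub_self,
    Polynomial.coeff_map, Polynomial.coeff_zero_eq_eval_zero]
  simpa using h0

theorem conjReverse_ne_zero {n : ℕ} {f : ℂ[X]} (hf : f ≠ 0) : conjReverse n f ≠ 0 := by
  intro h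
  rw [conjReverse, reflect_eq_zero_iff, Polynomial.map_eq_zero] at h
  exact hf h

theorem conjReverse_C_mul (n : ℕ) (t : ℂ) (f : ℂ[X]) :
    conjReverse n (C t * f) = C (conj t) * conjReverse n f := by
  rw [conjReverse, Polynomial.map_mul, Polynomial.map_C, Polynomial.reflect_C_mul, conjReverse]

theorem conjReverse_eval_ne_zero {n : ℕ} {f : ℂ[X]} (hf : f.natDegree ≤ n) {w : ℂ} (hw : w ≠ 0)
    (h : f.eval (1 / conj w) ≠ 0) : (conjReverse n f).eval w ≠ 0 := by
  rw [conjReverse_eval n f hf w hw]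
  refine mul_ne_zero (pow_ne_zero _ hw) ?_
  simpa using h

theorem isCoprime_of_eval {p q : ℂ[X]} (h : ∀ z, p.eval z = 0 → q.eval z ≠ 0) : IsCoprime p q := by
  rw [Polynomial.isCoprime_iff_aeval_ne_zero_of_isAlgClosed ℂ ℂ]
  intro a
  simp only [Polynomial.coe_aeval_eq_eval]
  by_cases hp : p.eval a = 0
  · exact Or.inr (h a hp)
  · exact Or.inl hp

/-- If `S` has no zero in the closed disc and `f` none in the open disc, then `S` and `f^{∼k}` are
coprime, since the zeros of `f^{∼k}` lie in the closed disc. -/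
theorem isCoprime_conjReverse {k : ℕ} {S f : ℂ[X]} (hS : ∀ z, ‖z‖ ≤ 1 → S.eval z ≠ 0)
    (hk : f.natDegree ≤ k) (hf : ∀ z, ‖z‖ < 1 → f.eval z ≠ 0) : IsCoprime S (conjReverse k f) := by
  refine isCoprime_of_eval fun w hw => ?_
  have hw1 : 1 < ‖w‖ := by
    by_contra! h
    exact hS w h hw
  have hw0 : w ≠ 0 := by rintro rfl; simp at hw1; linarith
  refine conjReverse_eval_ne_zero hk hw0 (hf _ ?_)
  rw [norm_div, norm_one, Complex.norm_conj, one_div]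
  exact inv_lt_one_of_one_lt₀ hw1

/-- A quotient that is unimodular on the circle and has no pole in the closed disc is of the form
`D^{∼n} / D`: comparing zeros gives a unimodular multiple of `Q^{∼n} / Q`, and the constant is
absorbed into `D` by means of a square root. -/
theorem exists_conjReverse_quotient {P Q : ℂ[X]} (hPQ : IsCoprime P Q)
    (hQ : ∀ z, ‖z‖ ≤ 1 → Q.eval z ≠ 0) (hnorm : ∀ z, ‖z‖ = 1 → ‖P.eval z‖ = ‖Q.eval z‖)
    {n : ℕ} (hn : max P.natDegree Q.natDegree = n) :
    ∃ D : ℂ[X], D.natDegree ≤ n ∧ (∀ z, ‖z‖ ≤ 1 → D.eval z ≠ 0) ∧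
      P * D = conjReverse n D * Q := by
  have hPn : P.natDegree ≤ n := hn ▸ le_max_left _ _
  have hQn : Q.natDegree ≤ n := hn ▸ le_max_right _ _
  have hQ0 : Q.eval 0 ≠ 0 := hQ 0 (by simp)
  have hQne : Q ≠ 0 := by rintro rfl; simp at hQ0
  have hprod : P * conjReverse n P = Q * conjReverse n Q := by
    refine eq_of_eval_eq_on_circle fun z hz => ?_
    rw [eval_mul, eval_mul, mul_conjReverse_eval_circle hPn hz,
      mul_conjReverse_eval_circle hQn hz, hnorm z hz]
  obtain ⟨g, hg⟩ : Q ∣ conjReverse n P :=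
    hPQ.symm.dvd_of_dvd_mul_left (hprod ▸ dvd_mul_right Q _)
  have hPg : P * g = conjReverse n Q := by
    refine mul_left_cancel₀ hQne ?_
    rw [← hprod, hg]
    ring
  have hdeg : (P * g).natDegree = n := by rw [hPg, natDegree_conjReverse hQn hQ0]
  have hQr : conjReverse n Q ≠ 0 := conjReverse_ne_zero hQne
  have hP0 : P ≠ 0 := by rintro rfl; exact hQr (by rw [← hPg, zero_mul])
  have hg0 : g ≠ 0 := by rintro rfl; exact hQr (by rw [← hPg, mul_zero])
  have hgdeg : g.natDegree = 0 := by
    rw [natDegree_mul hP0 hg0] at hdeg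
    have h2 := natDegree_conjReverse_le hPn
    rw [hg, natDegree_mul hQne hg0] at h2
    omega
  obtain ⟨c, rfl⟩ : ∃ c, g = C c := ⟨_, eq_C_of_natDegree_eq_zero hgdeg⟩
  have hc : ‖c‖ = 1 := by
    have h1 := congrArg (fun f => ‖eval 1 f‖) hg
    have h2 := hnorm 1 norm_one
    simp only [conjReverse_eval_circle hPn norm_one, one_pow, one_mul, Complex.norm_conj, eval_mul,
      eval_C, norm_mul, h2] at h1
    have h3 : ‖Q.eval 1‖ ≠ 0 := norm_ne_zero_iff.2 (hQ 1 (by simp))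
    exact (mul_left_cancel₀ h3 (by linarith)).symm
  obtain ⟨ζ, hζ⟩ := IsAlgClosed.exists_pow_nat_eq c (n := 2) two_pos
  have hζ1 : ‖ζ‖ = 1 := by
    have : ‖ζ‖ ^ 2 = 1 := by rw [← norm_pow, hζ, hc]
    nlinarith [norm_nonneg ζ]
  have hζ0 : ζ ≠ 0 := by rintro rfl; simp at hζ1
  refine ⟨C ζ * Q, (natDegree_C_mul_le _ _).trans hQn, fun z hz => ?_, ?_⟩
  · rw [eval_mul, eval_C]
    exact mul_ne_zero hζ0 (hQ z hz)
  · rw [conjReverse_C_mul, ← hPg, ← hζ]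
    have h1 : C ζ * C (conj ζ) = (1 : ℂ[X]) := by
      rw [← C_mul, mul_conj_eq_one hζ1, C_1]
    rw [C_pow]
    linear_combination (-(P * C ζ * Q)) * h1

/-- The denominator of `R / S` divides `D`, up to factors of `R`, if `s = R / S` and
`p = D^{∼n} / D` satisfy `s = s̄ p` on the circle. -/
theorem dvd_mul_of_symmetry {R S D : ℂ[X]} {n : ℕ} (hS : ∀ z, ‖z‖ ≤ 1 → S.eval z ≠ 0)
    (h : ∀ z, ‖z‖ = 1 → R.eval z * conj (S.eval z) * D.eval z
      = conj (R.eval z) * S.eval z * (conjReverse n D).eval z) : S ∣ R * D := by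
  set k := max R.natDegree S.natDegree with hk
  have hR : R.natDegree ≤ k := le_max_left _ _
  have hSk : S.natDegree ≤ k := le_max_right _ _
  have hpoly : R * conjReverse k S * D = conjReverse k R * S * conjReverse n D := by
    refine eq_of_eval_eq_on_circle fun z hz => ?_
    simp only [eval_mul, conjReverse_eval_circle hR hz, conjReverse_eval_circle hSk hz]
    linear_combination z ^ k * h z hz
  refine (isCoprime_conjReverse hS hSk fun z hz => hS z hz.le).dvd_of_dvd_mul_right ?_
  exact ⟨conjReverse k R * conjReverse n D, by linear_combination hpoly⟩

theorem natDegree_le_of_symmetry {N : ℂ[X]} {n : ℕ}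
    (h : ∀ z, ‖z‖ = 1 → N.eval z = z ^ n * conj (N.eval z)) : N.natDegree ≤ n := by
  by_cases hN : N = 0
  · simp [hN]
  -- the degree is `2 deg N` on the left and at most `n + deg N` on the right
  have hpoly : X ^ N.natDegree * N = X ^ n * conjReverse N.natDegree N := by
    refine eq_of_eval_eq_on_circle fun z hz => ?_
    simp only [eval_mul, eval_pow, eval_X, conjReverse_eval_circle le_rfl hz]
    linear_combination z ^ N.natDegree * h z hz
  have hdeg := congrArg natDegree hpoly
  rw [natDegree_mul (pow_ne_zero _ X_ne_zero) hN, natDegree_X_pow] at hdeg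
  have h1 := natDegree_mul_le (p := (X : ℂ[X]) ^ n) (q := conjReverse N.natDegree N)
  rw [natDegree_X_pow] at h1
  have h2 := natDegree_conjReverse_le (le_refl N.natDegree)
  omega

/-- The polynomial `D D^{∼n} - N N^{∼n} / 4`, which equals `zⁿ (|D|² - |N|² / 4)` on the circle. -/
def circlePoly (n : ℕ) (N D : ℂ[X]) : ℂ[X] :=
  D * conjReverse n D - C (1 / 4) * (N * conjReverse n N)

theorem circlePoly_eval {n : ℕ} {N D : ℂ[X]} (hN : N.natDegree ≤ n) (hD : D.natDegree ≤ n) {z : ℂ}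
    (hz : ‖z‖ = 1) : (circlePoly n N D).eval z
      = z ^ n * ((‖D.eval z‖ ^ 2 - ‖N.eval z‖ ^ 2 / 4 : ℝ) : ℂ) := by
  rw [circlePoly, eval_sub, eval_mul, eval_mul, eval_mul, eval_C,
    mul_conjReverse_eval_circle hN hz, mul_conjReverse_eval_circle hD hz]
  push_cast
  ring

theorem natDegree_circlePoly_le {n : ℕ} {N D : ℂ[X]} (hN : N.natDegree ≤ n)
    (hD : D.natDegree ≤ n) : (circlePoly n N D).natDegree ≤ 2 * n := by
  refine (natDegree_sub_le _ _).trans (max_le ?_ ((natDegree_C_mul_le _ _).trans ?_)) <;>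
    refine natDegree_mul_le.trans ?_
  · have := natDegree_conjReverse_le hD; omega
  · have := natDegree_conjReverse_le hN; omega

/-- The denominator of `R / S` divides `D`, up to factors of `R`, if
`|R / S|² = 1 - |N / D|² / 4` on the circle and `R` has no zero in the open disc. The last condition
keeps the zeros of `R^{∼k}` away from those of `S`. -/
theorem dvd_mul_of_circle {R S N D : ℂ[X]} {n : ℕ} (hR : ∀ z, ‖z‖ < 1 → R.eval z ≠ 0)
    (hS : ∀ z, ‖z‖ ≤ 1 → S.eval z ≠ 0) (hD : ∀ z, ‖z‖ ≤ 1 → D.eval z ≠ 0)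
    (hNn : N.natDegree ≤ n) (hDn : D.natDegree ≤ n)
    (h : ∀ z, ‖z‖ = 1 → ‖R.eval z‖ ^ 2 * ‖D.eval z‖ ^ 2
      = ‖S.eval z‖ ^ 2 * (‖D.eval z‖ ^ 2 - ‖N.eval z‖ ^ 2 / 4)) : S ∣ R * D := by
  set k := max R.natDegree S.natDegree with hk
  have hRk : R.natDegree ≤ k := le_max_left _ _
  have hSk : S.natDegree ≤ k := le_max_right _ _
  have hpoly : (R * conjReverse k R) * (D * conjReverse n D)
      = (S * conjReverse k S) * circlePoly n N D := by
    refine eq_of_eval_eq_on_circle fun z hz => ?_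
    simp only [eval_mul]
    rw [mul_conjReverse_eval_circle hRk hz, mul_conjReverse_eval_circle hDn hz,
      mul_conjReverse_eval_circle hSk hz, circlePoly_eval hNn hDn hz]
    have := congrArg (fun t : ℝ => (t : ℂ)) (h z hz)
    push_cast at this ⊢
    linear_combination (z ^ k * z ^ n) * this
  have hcop : IsCoprime S (conjReverse k R * conjReverse n D) :=
    (isCoprime_conjReverse hS hRk hR).mul_right
      (isCoprime_conjReverse hS hDn fun z hz => hD z hz.le)
  refine hcop.dvd_of_dvd_mul_right ?_
  exact ⟨conjReverse k S * circlePoly n N D, by linear_combination hpoly⟩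

/-- Since `N₁(0) ≠ 0`, the polynomial `N₁^{∼k}` with `k = deg N₁` has the full degree `k`, and the
bound comes from comparing degrees in `N₁ N₁^{∼k} zⁿ = zᵏ (D D^{∼n} - N N^{∼n} / 4)`. -/
theorem natDegree_le_of_circle {N₁ N D : ℂ[X]} {n : ℕ} (h0 : N₁.eval 0 ≠ 0)
    (hNn : N.natDegree ≤ n) (hDn : D.natDegree ≤ n)
    (h : ∀ z, ‖z‖ = 1 → ‖N₁.eval z‖ ^ 2 = ‖D.eval z‖ ^ 2 - ‖N.eval z‖ ^ 2 / 4) :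
    N₁.natDegree ≤ n := by
  set k := N₁.natDegree with hk
  have hN₁ : N₁ ≠ 0 := by rintro rfl; simp at h0
  have hkr := natDegree_conjReverse hk.ge h0
  have hpoly : X ^ n * (N₁ * conjReverse k N₁) = X ^ k * circlePoly n N D := by
    refine eq_of_eval_eq_on_circle fun z hz => ?_
    simp only [eval_mul]
    rw [mul_conjReverse_eval_circle hk.ge hz,
      circlePoly_eval hNn hDn hz, h z hz, eval_pow, eval_pow, eval_X]
    ring
  have hr0 : conjReverse k N₁ ≠ 0 := conjReverse_ne_zero hN₁
  have hdeg := congrArg natDegree hpoly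
  rw [natDegree_mul (pow_ne_zero _ X_ne_zero) (mul_ne_zero hN₁ hr0), natDegree_mul hN₁ hr0, hkr,
    natDegree_X_pow] at hdeg
  have h1 := natDegree_mul_le (p := (X : ℂ[X]) ^ k) (q := circlePoly n N D)
  rw [natDegree_X_pow] at h1
  have h2 := natDegree_circlePoly_le hNn hDn
  omega

/-! ### Finite Blaschke products -/

theorem norm_blaschke_factor {a z : ℂ} (ha : ‖a‖ < 1) (hz : ‖z‖ = 1) :
    ‖(z - a) / (1 - conj a * z)‖ = 1 := by
  have := norm_mobius_eq_one (a := -a) (by simpa using ha) hz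
  simpa [sub_eq_add_neg] using this

theorem IsFiniteBlaschke.norm_eq_one {B : ℂ → ℂ} (hB : IsFiniteBlaschke B) {z : ℂ}
    (hz : ‖z‖ = 1) : ‖B z‖ = 1 := by
  obtain ⟨θ, m, a, ha, h⟩ := hB
  rw [h, norm_mul, Complex.norm_exp_ofReal_mul_I, one_mul, norm_prod]
  exact Finset.prod_eq_one fun j _ => norm_blaschke_factor (ha j) hz

/-- The zeros of a polynomial in the open disc can be split off as a finite Blaschke product. -/
theorem exists_blaschke_factorization {P : ℂ[X]} (hP : P ≠ 0) :
    ∃ (B : ℂ → ℂ) (R : ℂ[X]), IsFiniteBlaschke B ∧ (∀ z, ‖z‖ < 1 → R.eval z ≠ 0) ∧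
      ∀ z, ‖z‖ ≤ 1 → P.eval z = B z * R.eval z := by
  induction hd : P.natDegree generalizing P with
  | zero =>
    refine ⟨fun _ => 1, P, ⟨0, 0, Fin.elim0, fun j => j.elim0, by simp⟩, fun z _ => ?_, by simp⟩
    rw [eq_C_of_natDegree_eq_zero hd] at hP ⊢
    simpa using hP
  | succ d ih =>
    by_cases hroot : ∃ b, ‖b‖ < 1 ∧ P.eval b = 0
    · obtain ⟨b, hb, hPb⟩ := hroot
      obtain ⟨P', rfl⟩ := dvd_iff_isRoot.2 hPb
      have hP' : P' ≠ 0 := right_ne_zero_of_mul hP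
      rw [natDegree_mul (X_sub_C_ne_zero b) hP', natDegree_X_sub_C] at hd
      obtain ⟨B, R, ⟨θ, m, a, ha, hB⟩, hR, hPR⟩ := ih hP' (by omega)
      have hden : ∀ z, ‖z‖ ≤ 1 → 1 - conj b * z ≠ 0 := fun z hz => by
        have := one_add_conj_mul_ne_zero (a := -b) (by simpa using hb) hz
        simpa [sub_eq_add_neg] using this
      refine ⟨fun z => (z - b) / (1 - conj b * z) * B z, (1 - C (conj b) * X) * R,
        ⟨θ, m + 1, Fin.cons b a, ?_, ?_⟩, ?_, ?_⟩
      · intro j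
        refine Fin.cases ?_ (fun i => ?_) j
        · simpa using hb
        · simpa using ha i
      · intro z
        rw [Fin.prod_univ_succ]
        simp only [Fin.cons_zero, Fin.cons_succ, hB z]
        ring
      · intro z hz
        rw [eval_mul]
        refine mul_ne_zero ?_ (hR z hz)
        simpa using hden z hz.le
      · intro z hz
        have := hden z hz
        simp only [eval_mul, eval_sub, eval_X, eval_C, eval_one, hPR z hz]
        generalize 1 - conj b * z = c at this ⊢
        field_simp
    · push Not at hroot
      exact ⟨fun _ => 1, P, ⟨0, 0, Fin.elim0, fun j => j.elim0, by simp⟩, hroot, by simp⟩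

/-! ### Quotients of polynomials as rational functions -/

theorem ratEval_eq (x : RatFunc ℂ) (z : ℂ) : ratEval x z = x.num.eval z / x.denom.eval z := rfl

theorem ratQuot_num_denom (x : RatFunc ℂ) : ratQuot x.num x.denom = x := RatFunc.num_div_denom x

theorem ratQuot_eq_iff {p q p' q' : ℂ[X]} (hq : q ≠ 0) (hq' : q' ≠ 0) :
    ratQuot p q = ratQuot p' q' ↔ p * q' = p' * q := by
  rw [ratQuot, ratQuot, div_eq_div_iff (RatFunc.algebraMap_ne_zero hq)
    (RatFunc.algebraMap_ne_zero hq'), ← map_mul, ← map_mul]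
  exact (RatFunc.algebraMap_injective ℂ).eq_iff

theorem num_mul_ratQuot {p q : ℂ[X]} (hq : q ≠ 0) :
    (ratQuot p q).num * q = p * (ratQuot p q).denom :=
  (ratQuot_eq_iff (RatFunc.denom_ne_zero _) hq).1 (ratQuot_num_denom _)

theorem ratQuot_denom_eval {p q : ℂ[X]} {z : ℂ} (hz : q.eval z ≠ 0) :
    (ratQuot p q).denom.eval z ≠ 0 := by
  obtain ⟨g, hg⟩ := RatFunc.denom_div_dvd p q
  intro h
  refine hz ?_
  have h' : ((algebraMap ℂ[X] (RatFunc ℂ)) p / (algebraMap ℂ[X] (RatFunc ℂ)) q).denom.eval z = 0 :=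
    h
  rw [hg, eval_mul, h', zero_mul]

theorem ratEval_ratQuot {p q : ℂ[X]} {z : ℂ} (hz : q.eval z ≠ 0) :
    ratEval (ratQuot p q) z = p.eval z / q.eval z := by
  have hq : q ≠ 0 := by rintro rfl; simp at hz
  rw [ratEval_eq, div_eq_div_iff (ratQuot_denom_eval hz) hz, ← eval_mul, ← eval_mul,
    num_mul_ratQuot hq]

theorem ratDegree_ratQuot {p q : ℂ[X]} (hp : p ≠ 0) (hq : q ≠ 0) (h : IsCoprime p q) :
    ratDegree (ratQuot p q) = max p.natDegree q.natDegree := by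
  have e := num_mul_ratQuot (p := p) hq
  have hd := RatFunc.denom_ne_zero (ratQuot p q)
  have hn : (ratQuot p q).num ≠ 0 := by
    intro h0
    rw [h0, zero_mul] at e
    exact mul_ne_zero hp hd e.symm
  have d1 : q ∣ (ratQuot p q).denom := h.symm.dvd_of_dvd_mul_left (e ▸ dvd_mul_left q _)
  have d2 : p ∣ (ratQuot p q).num := h.dvd_of_dvd_mul_right (e ▸ dvd_mul_right p _)
  have n1 := natDegree_le_of_dvd d1 hd
  have n2 := natDegree_le_of_dvd d2 hn
  have n3 := natDegree_le_of_dvd (RatFunc.denom_div_dvd p q) hq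
  have n4 := natDegree_le_of_dvd (RatFunc.num_div_dvd p hq) hp
  exact congrArg₂ max (le_antisymm n4 n2) (le_antisymm n3 n1)

/-! ### Rational inner functions from polynomials -/

theorem ratEval_vec2 {p q D : ℂ[X]} {z : ℂ} (hz : D.eval z ≠ 0) :
    (fun i => ratEval ((![ratQuot p D, ratQuot q D] : Fin 2 → RatFunc ℂ) i) z)
      = ![p.eval z / D.eval z, q.eval z / D.eval z] := by
  ext i; fin_cases i
  · exact ratEval_ratQuot hz
  · exact ratEval_ratQuot hz

theorem ratEval_vec3 {o p q D : ℂ[X]} {z : ℂ} (hz : D.eval z ≠ 0) :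
    (fun i => ratEval ((![ratQuot o D, ratQuot p D, ratQuot q D] : Fin 3 → RatFunc ℂ) i) z)
      = ![o.eval z / D.eval z, p.eval z / D.eval z, q.eval z / D.eval z] := by
  ext i; fin_cases i
  · exact ratEval_ratQuot hz
  · exact ratEval_ratQuot hz
  · exact ratEval_ratQuot hz

theorem IsGammaPair.eval_ne_zero {n : ℕ} {N₂ D : ℂ[X]} (h : IsGammaPair n N₂ D) {z : ℂ}
    (hz : ‖z‖ ≤ 1) : D.eval z ≠ 0 :=
  h.no_zero z (by simpa using hz)

theorem IsGammaPair.ne_zero {n : ℕ} {N₂ D : ℂ[X]} (h : IsGammaPair n N₂ D) : D ≠ 0 := by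
  rintro rfl
  exact h.eval_ne_zero (z := 0) (by simp) (by simp)

theorem IsGammaPair.mem_gammaShilov {n : ℕ} {N₂ D : ℂ[X]} (h : IsGammaPair n N₂ D) {z : ℂ}
    (hz : ‖z‖ = 1) :
    ![N₂.eval z / D.eval z, (conjReverse n D).eval z / D.eval z] ∈ gammaShilov := by
  rw [← ratEval_vec2 (h.eval_ne_zero hz.le), ← distinguishedBoundary_symmetrizedBidisc]
  exact h.inner.mapsCircle z (by simpa using hz)

theorem IsGammaPair.mem_closure {n : ℕ} {N₂ D : ℂ[X]} (h : IsGammaPair n N₂ D) {z : ℂ}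
    (hz : ‖z‖ ≤ 1) : ![N₂.eval z / D.eval z, (conjReverse n D).eval z / D.eval z] ∈
      closure symmetrizedBidisc := by
  rcases hz.lt_or_eq with hz | hz
  · rw [← ratEval_vec2 (h.eval_ne_zero hz.le)]
    exact h.inner.mapsDisc z (by simpa using hz)
  · exact isBoundary_gammaShilov.1 (h.mem_gammaShilov hz)

theorem mem_pentaShilov_of_circleIdentity {n : ℕ} {N₁ N₂ D : ℂ[X]} (h : IsGammaPair n N₂ D)
    (hc : CircleIdentity N₁ N₂ D) {z : ℂ} (hz : ‖z‖ = 1) :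
    ![N₁.eval z / D.eval z, N₂.eval z / D.eval z, (conjReverse n D).eval z / D.eval z]
      ∈ pentaShilov := by
  obtain ⟨h1, h2, h3⟩ := h.mem_gammaShilov hz
  refine ⟨by simpa using h1, by simpa using h2, ?_⟩
  simp only [Matrix.cons_val_zero, Matrix.cons_val_one, norm_div, div_pow]
  have hD : ‖D.eval z‖ ≠ 0 := norm_ne_zero_iff.2 (h.eval_ne_zero hz.le)
  rw [hc z (by simpa using hz)]
  field_simp

/-- The maximum principle for the first coordinate after a Möbius map that moves the last two
coordinates at `z` to trace zero. The dilation by `r < 1` keeps these inside `𝔾`, where such a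
Möbius map exists. -/
theorem smul_mem_closure_of_circleIdentity {n : ℕ} {N₁ N₂ D : ℂ[X]} (h : IsGammaPair n N₂ D)
    (hc : CircleIdentity N₁ N₂ D) {z : ℂ} (hz : ‖z‖ < 1) {r : ℝ} (hr0 : 0 < r) (hr : r < 1) :
    ![r * (N₁.eval z / D.eval z), r * (N₂.eval z / D.eval z),
      r ^ 2 * ((conjReverse n D).eval z / D.eval z)] ∈ closure pentablock := by
  have hP : ∀ y : ℂ, ‖y‖ ≤ 1 → ![0, r * (N₂.eval y / D.eval y),
      r ^ 2 * ((conjReverse n D).eval y / D.eval y)] ∈ pentablock := fun y hy =>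
    smul_incl_mem_pentablock (h.mem_closure hy) hr0.le hr
  obtain ⟨α, hα, h0⟩ := exists_trace_pentaMobius_eq_zero (hP z hz.le)
  have hden : ∀ y : ℂ, ‖y‖ ≤ 1 → 1 - conj α * (r * (N₂.eval y / D.eval y))
      + conj α ^ 2 * (r ^ 2 * ((conjReverse n D).eval y / D.eval y)) ≠ 0 := fun y hy => by
    simpa [mobiusDenom] using mobiusDenom_ne_zero (subset_closure (hP y hy)) hα
  set F : ℂ → ℂ := fun y => (1 - α * conj α) * (r * (N₁.eval y / D.eval y)) /
    (1 - conj α * (r * (N₂.eval y / D.eval y))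
      + conj α ^ 2 * (r ^ 2 * ((conjReverse n D).eval y / D.eval y))) with hF
  have hFd : DiffContOnCl ℂ F (Metric.ball 0 1) := by
    refine DifferentiableOn.diffContOnCl fun y hy => DifferentiableAt.differentiableWithinAt ?_
    rw [closure_ball _ one_ne_zero, mem_closedBall_zero_iff] at hy
    have hD := h.eval_ne_zero hy
    have hQ := hden y hy
    have d1 : DifferentiableAt ℂ (fun y => N₁.eval y / D.eval y) y :=
      N₁.differentiable.differentiableAt.fun_div D.differentiable.differentiableAt hD
    have d2 : DifferentiableAt ℂ (fun y => N₂.eval y / D.eval y) y :=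
      N₂.differentiable.differentiableAt.fun_div D.differentiable.differentiableAt hD
    have d3 : DifferentiableAt ℂ (fun y => (conjReverse n D).eval y / D.eval y) y :=
      (conjReverse n D).differentiable.differentiableAt.fun_div
        D.differentiable.differentiableAt hD
    exact ((d1.const_mul _).const_mul _).fun_div
      ((((d2.const_mul _).const_mul _).const_sub 1).fun_add ((d3.const_mul _).const_mul _)) hQ
  have hFz : ‖F z‖ ≤ 1 := by
    refine Complex.norm_le_of_forall_mem_frontier_norm_le Metric.isBounded_ball hFd
      (fun y hy => ?_) (by rw [closure_ball _ one_ne_zero]; simpa using hz.le)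
    rw [frontier_ball _ one_ne_zero, mem_sphere_zero_iff_norm] at hy
    have hm := pentaMobius_mem_closure hα (smul_mem_closure_pentablock hr0.le hr.le
      (pentaShilov_subset_closure (mem_pentaShilov_of_circleIdentity h hc hy)))
    have hb := (closure_pentablock_bounds hm).2.1
    have e : pentaMobius α ![r * (N₁.eval y / D.eval y), r * (N₂.eval y / D.eval y),
        r ^ 2 * ((conjReverse n D).eval y / D.eval y)] 0 = F y := by
      simp [pentaMobius, mobiusDenom, hF]
    simp only [Matrix.cons_val_zero, Matrix.cons_val_one, Matrix.cons_val, e] at hb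
    nlinarith [norm_nonneg (F y), sq_nonneg ‖pentaMobius α ![r * (N₁.eval y / D.eval y),
      r * (N₂.eval y / D.eval y), r ^ 2 * ((conjReverse n D).eval y / D.eval y)] 1‖]
  set w := ![r * (N₁.eval z / D.eval z), r * (N₂.eval z / D.eval z),
      r ^ 2 * ((conjReverse n D).eval z / D.eval z)] with hw
  set w' := ![0, r * (N₂.eval z / D.eval z),
      r ^ 2 * ((conjReverse n D).eval z / D.eval z)] with hw'
  have hv := (pentablock_bounds (pentaMobius_mem hα (hP z hz.le))).1
  have hslice : pentaMobius α w = ![F z, 0, pentaMobius α w' 2] := by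
    ext i
    fin_cases i
    · simp [pentaMobius, mobiusDenom, hF, hw]
    · rw [← h0]
      simp [pentaMobius, mobiusDenom, hw, hw']
    · simp [pentaMobius, mobiusDenom, hw, hw']
  have hdenw : mobiusDenom α w ≠ 0 := by
    simpa [mobiusDenom, hw] using hden z hz.le
  rw [← pentaMobius_neg_pentaMobius hα hdenw, hslice]
  exact pentaMobius_mem_closure (by simpa using hα)
    (mem_closure_pentablock_of_trace_zero hFz hv.le)

theorem isRationalInner_of_circleIdentity {n : ℕ} {N₁ N₂ D : ℂ[X]} (h : IsGammaPair n N₂ D)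
    (hc : CircleIdentity N₁ N₂ D) : IsRationalInner pentablock
      ![ratQuot N₁ D, ratQuot N₂ D, ratQuot (conjReverse n D) D] := by
  refine ⟨fun i z hz => ?_, fun z hz => ?_, fun z hz => ?_⟩
  · have hD := h.no_zero z hz
    fin_cases i
    · exact ratQuot_denom_eval hD
    · exact ratQuot_denom_eval hD
    · exact ratQuot_denom_eval hD
  · have hz : ‖z‖ < 1 := by simpa using hz
    rw [ratEval_vec3 (h.eval_ne_zero hz.le)]
    have hcont : Continuous fun r : ℝ => ![(r : ℂ) * (N₁.eval z / D.eval z),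
        r * (N₂.eval z / D.eval z), (r : ℂ) ^ 2 * ((conjReverse n D).eval z / D.eval z)] :=
      continuous_vec3 (by fun_prop) (by fun_prop) (by fun_prop)
    -- the dilated points lie in the closure, and they tend to the point itself as `r → 1`
    have hlim := (hcont.tendsto 1).mono_left (nhdsWithin_le_nhds (s := Set.Iio 1))
    simp only [Complex.ofReal_one, one_mul, one_pow] at hlim
    refine isClosed_closure.mem_of_tendsto hlim ?_
    filter_upwards [Ioo_mem_nhdsLT zero_lt_one] with r hr
    exact smul_mem_closure_of_circleIdentity h hc hz hr.1 hr.2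
  · have hz : ‖z‖ = 1 := by simpa using hz
    rw [ratEval_vec3 (h.eval_ne_zero hz.le), distinguishedBoundary_pentablock]
    exact mem_pentaShilov_of_circleIdentity h hc hz

theorem isCoprime_conjReverse_self {n : ℕ} {D : ℂ[X]} (hD : ∀ z, ‖z‖ ≤ 1 → D.eval z ≠ 0)
    (hn : D.natDegree ≤ n) : IsCoprime D (conjReverse n D) :=
  isCoprime_conjReverse hD hn fun z hz => hD z hz.le

theorem IsGammaPair.ratDegree_eq {n : ℕ} {N₂ D : ℂ[X]} (h : IsGammaPair n N₂ D) :
    ratDegree (ratQuot (conjReverse n D) D) = n := by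
  rw [ratDegree_ratQuot (conjReverse_ne_zero h.ne_zero) h.ne_zero
    (isCoprime_conjReverse_self (fun _ hz => h.eval_ne_zero hz) h.degree_le).symm,
    natDegree_conjReverse h.degree_le (h.eval_ne_zero (by simp))]
  exact max_eq_left h.degree_le

/-! ### Polynomial representations of rational pentablock-inner functions -/

theorem exists_represents {n : ℕ} {x : Fin 3 → RatFunc ℂ} (hx : IsRationalInner pentablock x)
    (hn : ratDegree (x 2) = n) : ∃ (N₁ N₂ D : ℂ[X]) (B : ℂ → ℂ),
      IsFiniteBlaschke B ∧ Represents n x B N₁ N₂ D := by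
  have hpole : ∀ i z, ‖z‖ ≤ 1 → (x i).denom.eval z ≠ 0 := fun i z hz =>
    hx.poles i z (by simpa using hz)
  have hcirc : ∀ z, ‖z‖ = 1 → (fun i => ratEval (x i) z) ∈ pentaShilov := fun z hz => by
    rw [← distinguishedBoundary_pentablock]
    exact hx.mapsCircle z (by simpa using hz)
  -- the last coordinate is unimodular on the circle, which determines `D`
  obtain ⟨D, hDn, hD, hPD⟩ := exists_conjReverse_quotient (RatFunc.isCoprime_num_denom (x 2))
    (hpole 2) (fun z hz => by
      have h1 : ‖ratEval (x 2) z‖ = 1 := (hcirc z hz).1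
      rw [ratEval_eq, norm_div, div_eq_one_iff_eq (norm_ne_zero_iff.2 (hpole 2 z hz.le))] at h1
      exact h1) hn
  have hD0 : D ≠ 0 := by
    rintro rfl
    exact hD 0 (by simp) (by simp)
  have hx2 : x 2 = ratQuot (conjReverse n D) D := by
    rw [← ratQuot_num_denom (x 2), ratQuot_eq_iff (RatFunc.denom_ne_zero _) hD0, hPD]
  have hconjD : ∀ z, ‖z‖ = 1 → conj (D.eval z) ≠ 0 := fun z hz => by simpa using hD z hz.le
  have hsym : ∀ z, ‖z‖ = 1 → ratEval (x 1) z
      = conj (ratEval (x 1) z) * ((conjReverse n D).eval z / D.eval z) := fun z hz => by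
    have h1 : ratEval (x 1) z = conj (ratEval (x 1) z) * ratEval (x 2) z := (hcirc z hz).2.1
    rwa [hx2, ratEval_ratQuot (hD z hz.le)] at h1
  -- the relation `s = s̄ p` makes `D` a denominator for the second coordinate
  obtain ⟨N₂, hN₂⟩ : (x 1).denom ∣ (x 1).num * D := by
    refine dvd_mul_of_symmetry (n := n) (hpole 1) fun z hz => ?_
    have h1 := hsym z hz
    have hS := hpole 1 z hz.le
    have hS' : conj ((x 1).denom.eval z) ≠ 0 := by simpa using hS
    have hDz := hD z hz.le
    rw [ratEval_eq, map_div₀] at h1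
    field_simp at h1
    linear_combination h1
  have hx1 : x 1 = ratQuot N₂ D := by
    conv_lhs => rw [← ratQuot_num_denom (x 1)]
    rw [ratQuot_eq_iff (RatFunc.denom_ne_zero _) hD0, hN₂, mul_comm]
  have hN₂n : N₂.natDegree ≤ n := by
    refine natDegree_le_of_symmetry fun z hz => ?_
    have h1 := hsym z hz
    have hDz := hD z hz.le
    have hDz' := hconjD z hz
    rw [hx1, ratEval_ratQuot hDz, map_div₀, conjReverse_eval_circle hDn hz] at h1
    field_simp at h1
    linear_combination h1
  have hgamma : IsGammaPair n N₂ D := by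
    refine ⟨hDn, fun z hz => hD z (by simpa using hz), ?_⟩
    rw [← hx1, ← hx2]
    have e : ∀ z, (fun i => ratEval ((![x 1, x 2] : Fin 2 → RatFunc ℂ) i) z)
        = ![ratEval (x 1) z, ratEval (x 2) z] := by
      intro z
      ext i; fin_cases i <;> rfl
    refine ⟨fun i z hz => ?_, fun z hz => ?_, fun z hz => ?_⟩
    · fin_cases i
      · exact hx.poles 1 z hz
      · exact hx.poles 2 z hz
    · rw [e]
      exact proj_mem_closure (hx.mapsDisc z hz)
    · rw [e, distinguishedBoundary_symmetrizedBidisc]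
      exact proj_mem_gammaShilov (hcirc z (by simpa using hz))
  have hfirst : ∀ z, ‖z‖ = 1 →
      ‖ratEval (x 0) z‖ ^ 2 * ‖D.eval z‖ ^ 2 = ‖D.eval z‖ ^ 2 - ‖N₂.eval z‖ ^ 2 / 4 := by
    intro z hz
    have h1 : ‖ratEval (x 0) z‖ ^ 2 = 1 - ‖ratEval (x 1) z‖ ^ 2 / 4 := (hcirc z hz).2.2
    have hDz : ‖D.eval z‖ ≠ 0 := norm_ne_zero_iff.2 (hD z hz.le)
    rw [h1, hx1, ratEval_ratQuot (hD z hz.le), norm_div]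
    field_simp
  have hcircle : ∀ (B : ℂ → ℂ) (N₁ : ℂ[X]), IsFiniteBlaschke B →
      (∀ z, ‖z‖ ≤ 1 → ratEval (x 0) z = B z * (N₁.eval z / D.eval z)) →
        CircleIdentity N₁ N₂ D := by
    intro B N₁ hB h z hz
    have hz : ‖z‖ = 1 := by simpa using hz
    have hDz : ‖D.eval z‖ ≠ 0 := norm_ne_zero_iff.2 (hD z hz.le)
    rw [← hfirst z hz, h z hz.le, norm_mul, hB.norm_eq_one hz, norm_div, one_mul]
    field_simp
  -- splitting off the zeros in the disc makes `D` a denominator for the rest of `x 0`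
  by_cases hx0 : (x 0).num = 0
  · have hB : IsFiniteBlaschke fun _ => 1 := ⟨0, 0, Fin.elim0, fun j => j.elim0, by simp⟩
    have h : ∀ z, ‖z‖ ≤ 1 → ratEval (x 0) z = 1 * ((0 : ℂ[X]).eval z / D.eval z) := by
      intro z _
      rw [ratEval_eq, hx0]
      simp
    exact ⟨0, N₂, D, fun _ => 1, hB, hgamma, hx1, hx2, fun z hz => h z (by simpa using hz),
      hcircle _ _ hB h, by simp⟩
  · obtain ⟨B, R, hB, hR, hPR⟩ := exists_blaschke_factorization hx0
    obtain ⟨N₁, hN₁⟩ : (x 0).denom ∣ R * D := by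
      refine dvd_mul_of_circle hR (hpole 0) hD hN₂n hDn fun z hz => ?_
      have hS : ‖(x 0).denom.eval z‖ ≠ 0 := norm_ne_zero_iff.2 (hpole 0 z hz.le)
      rw [← hfirst z hz, ratEval_eq, hPR z hz.le, norm_div, norm_mul, hB.norm_eq_one hz]
      field_simp
    have h : ∀ z, ‖z‖ ≤ 1 → ratEval (x 0) z = B z * (N₁.eval z / D.eval z) := by
      intro z hz
      have h1 := congrArg (eval z) hN₁
      rw [eval_mul, eval_mul] at h1
      have hDz := hD z hz
      have hS := hpole 0 z hz
      rw [ratEval_eq, hPR z hz, ← mul_div_assoc, div_eq_div_iff hS hDz]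
      linear_combination B z * h1
    have hN₁0 : N₁.eval 0 ≠ 0 := by
      intro h0
      have h1 := congrArg (eval 0) hN₁
      rw [eval_mul, eval_mul, h0, mul_zero] at h1
      exact mul_ne_zero (hR 0 (by simp)) (hD 0 (by simp)) h1
    have hc := hcircle B N₁ hB h
    exact ⟨N₁, N₂, D, B, hB, hgamma, hx1, hx2, fun z hz => h z (by simpa using hz), hc,
      natDegree_le_of_circle hN₁0 hN₂n hDn fun z hz => hc z (by simpa using hz)⟩

/-- Both `D` and `D'` are reduced denominators of `x 2`, so they differ by a constant, which is real because
`D ↦ D^{∼n}` is conjugate-linear. -/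
theorem exists_real_smul_of_represents {n : ℕ} {x : Fin 3 → RatFunc ℂ} {B : ℂ → ℂ}
    {N₁ N₂ D N₁' N₂' D' : ℂ[X]} (hB : IsFiniteBlaschke B) (h : Represents n x B N₁ N₂ D)
    (h' : Represents n x B N₁' N₂' D') :
    ∃ t : ℝ, t ≠ 0 ∧ N₁ = C (t : ℂ) * N₁' ∧ N₂ = C (t : ℂ) * N₂' ∧ D = C (t : ℂ) * D' := by
  have hD := h.gamma.ne_zero
  have hD' := h'.gamma.ne_zero
  have e3 := (ratQuot_eq_iff hD hD').1 (h.third.symm.trans h'.third)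
  have e2 := (ratQuot_eq_iff hD hD').1 (h.second.symm.trans h'.second)
  have cop := isCoprime_conjReverse_self (fun _ hz => h.gamma.eval_ne_zero hz) h.gamma.degree_le
  have cop' := isCoprime_conjReverse_self (fun _ hz => h'.gamma.eval_ne_zero hz)
    h'.gamma.degree_le
  have d1 : D ∣ D' := cop.dvd_of_dvd_mul_left (e3 ▸ dvd_mul_left D _)
  have d2 : D' ∣ D := cop'.dvd_of_dvd_mul_left (e3 ▸ dvd_mul_left D' _)
  obtain ⟨u, hu⟩ := associated_of_dvd_dvd d2 d1
  obtain ⟨c, hc, hcu⟩ := Polynomial.isUnit_iff.1 u.isUnit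
  have hc0 : c ≠ 0 := hc.ne_zero
  have hDc : D = C c * D' := by rw [← hu, ← hcu, mul_comm]
  have hconj : conj c = c := by
    have hr := conjReverse_ne_zero (n := n) hD'
    rw [hDc, conjReverse_C_mul] at e3
    have e4 : C (conj c) * (conjReverse n D' * D') = C c * (conjReverse n D' * D') := by
      linear_combination e3
    exact C_injective (mul_right_cancel₀ (mul_ne_zero hr hD') e4)
  obtain ⟨t, rfl⟩ := Complex.conj_eq_iff_real.1 hconj
  refine ⟨t, by simpa using hc0, ?_, ?_, hDc⟩
  · have e1 : N₁ * D' = N₁' * D := by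
      refine eq_of_eval_eq_on_circle fun z hz => ?_
      have hzc : z ∈ Metric.closedBall (0 : ℂ) 1 := by simpa using hz.le
      have hBz : B z ≠ 0 := by
        rw [← norm_ne_zero_iff, hB.norm_eq_one hz]
        exact one_ne_zero
      have e := mul_left_cancel₀ hBz ((h.first z hzc).symm.trans (h'.first z hzc))
      rw [div_eq_div_iff (h.gamma.eval_ne_zero hz.le) (h'.gamma.eval_ne_zero hz.le)] at e
      rw [eval_mul, eval_mul, e]
    refine mul_right_cancel₀ hD' ?_
    rw [e1, hDc]
    ring
  · refine mul_right_cancel₀ hD' ?_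
    rw [e2, hDc]
    ring

theorem represents_of_real_smul {n : ℕ} {x : Fin 3 → RatFunc ℂ} {B : ℂ → ℂ}
    {N₁ N₂ D : ℂ[X]} {t : ℝ} (ht : t ≠ 0)
    (h : Represents n x B (C (t : ℂ) * N₁) (C (t : ℂ) * N₂) (C (t : ℂ) * D)) :
    Represents n x B N₁ N₂ D := by
  have htC : (t : ℂ) ≠ 0 := by exact_mod_cast ht
  have hCt : (C (t : ℂ) : ℂ[X]) ≠ 0 := by simpa using htC
  obtain ⟨⟨hdeg, hzero, hinner⟩, h1, h2, h0, hcirc, hdeg1⟩ := h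
  have hDt : C (t : ℂ) * D ≠ 0 := by
    intro h
    have := hzero 0 (by simp)
    rw [h] at this
    simp at this
  have hD : D ≠ 0 := right_ne_zero_of_mul hDt
  have q2 : ratQuot (C (t : ℂ) * N₂) (C (t : ℂ) * D) = ratQuot N₂ D := by
    rw [ratQuot_eq_iff hDt hD]; ring
  have q3 : ratQuot (conjReverse n (C (t : ℂ) * D)) (C (t : ℂ) * D)
      = ratQuot (conjReverse n D) D := by
    rw [ratQuot_eq_iff hDt hD, conjReverse_C_mul, Complex.conj_ofReal]; ring
  rw [natDegree_C_mul htC] at hdeg hdeg1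
  rw [q2, q3] at hinner
  rw [q2] at h1
  rw [q3] at h2
  refine ⟨⟨hdeg, fun z hz => ?_, hinner⟩, h1, h2, fun z hz => ?_, fun z hz => ?_, hdeg1⟩
  · have := hzero z hz
    rw [eval_mul] at this
    exact right_ne_zero_of_mul this
  · rw [h0 z hz, eval_mul, eval_mul, eval_C, mul_div_mul_left _ _ htC]
  · have := hcirc z hz
    simp only [eval_mul, eval_C, norm_mul, mul_pow] at this
    have ht2 : 0 < ‖(t : ℂ)‖ ^ 2 := by positivity
    refine mul_left_cancel₀ ht2.ne' ?_
    linear_combination this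

end PentaInner

end

theorem theorem3p5 (n : ℕ) :
    (∀ x : Fin 3 → RatFunc ℂ,
      PentaInner.IsRationalInner PentaInner.pentablock x → PentaInner.ratDegree (x 2) = n →
        (∃ (N₁ N₂ D : Polynomial ℂ) (B : ℂ → ℂ),
          PentaInner.IsFiniteBlaschke B ∧ PentaInner.Represents n x B N₁ N₂ D) ∧
        (∀ (N₁ N₂ D : Polynomial ℂ) (B : ℂ → ℂ),
          PentaInner.IsFiniteBlaschke B → PentaInner.Represents n x B N₁ N₂ D →
            ∀ N₁' N₂' D' : Polynomial ℂ,
              PentaInner.Represents n x B N₁' N₂' D' ↔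
                ∃ t : ℝ, t ≠ 0 ∧ N₁ = Polynomial.C (t : ℂ) * N₁' ∧
                  N₂ = Polynomial.C (t : ℂ) * N₂' ∧ D = Polynomial.C (t : ℂ) * D')) ∧
    (∀ N₁ N₂ D : Polynomial ℂ,
      PentaInner.IsGammaPair n N₂ D → PentaInner.CircleIdentity N₁ N₂ D →
        PentaInner.IsRationalInner PentaInner.pentablock
          ![PentaInner.ratQuot N₁ D, PentaInner.ratQuot N₂ D,
            PentaInner.ratQuot (PentaInner.conjReverse n D) D] ∧
        PentaInner.ratDegree (PentaInner.ratQuot (PentaInner.conjReverse n D) D) = n) := by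
  refine ⟨fun x hx hn => ⟨PentaInner.exists_represents hx hn,
    fun N₁ N₂ D B hB h N₁' N₂' D' => ⟨PentaInner.exists_real_smul_of_represents hB h, ?_⟩⟩,
    fun N₁ N₂ D h hc => ⟨PentaInner.isRationalInner_of_circleIdentity h hc, h.ratDegree_eq⟩⟩
  rintro ⟨t, ht, rfl, rfl, rfl⟩
  exact PentaInner.represents_of_real_smul ht h
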